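/- Let $(R,\mathfrak m)$ be a commutative Noetherian local ring of Krull dimension $d$, let $r\ge 0$, let $E\subseteq F=R^r$ be a submodule such that the length $\lambda_R(F/E)$ is finite, and let $N$ be a finitely generated $R$-module. For $n\ge 0$ let $F^n=\mathrm{Sym}_n(F)$, and let $E^n\subseteq F^n$ be the degree-$n$ component of the image of the natural map $\mathrm{Sym}(E)\to\mathrm{Sym}(F)$. For a finitely generated $R$-module $M$ the Buchsbaum–Rim multiplicity of $E$ on $M$ is $$br(E,M)=\lim_{n\to\infty}(d+r-1)!\,\frac{\lambda_R\big((F^n/E^n)\otimes_R M\big)}{n^{d+r-1}},$$ always with $d=\dim R$ (if $d=r=0$, the number $d+r-1$ is read as $0$). Let $\Lambda=\{p\in\mathrm{Supp}(N) : \dim R/p=d\}$. Then $\Lambda$ is finite, the lengths $\lambda_{R_p}(N_p)$, $p\in\Lambda$, are finite, for $M=N$ and for $M=R/p$ with $p\in\Lambda$ the lengths in the definition of $br(E,M)$ are finite and the limit exists, and $$br(E,N)=\sum_{p\in\Lambda}\lambda_{R_p}(N_p)\,br(E,R/p).$$ -/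

import Mathlib

open Filter Topology

namespace BuchsbaumRim

section Sym

variable (R : Type*) [CommRing R] (M : Type*) [AddCommGroup M] [Module R M]

/-- The `n`-th degree component `Sym_n(M)` of the symmetric algebra of `M`: the `R`-span of all
products of `n` elements of `M`. -/
noncomputable def symComponent (n : ℕ) : Submodule R (SymmetricAlgebra R M) :=
  LinearMap.range (SymmetricAlgebra.ι R M) ^ n

variable {R M}

/-- The natural map `Sym(E) → Sym(M)` of symmetric algebras, for a submodule `E ⊆ M`. -/
noncomputable def symMap (E : Submodule R M) : SymmetricAlgebra R E →ₐ[R] SymmetricAlgebra R M :=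
  SymmetricAlgebra.lift (SymmetricAlgebra.ι R M ∘ₗ E.subtype)

/-- `E^n`: the `n`-th degree component of the Rees algebra of `E`. The Rees algebra is the image of
the graded map `Sym(E) → Sym(M)`, so its degree `n` component is the image of `Sym_n(E)`. -/
noncomputable def reesComponent (E : Submodule R M) (n : ℕ) :
    Submodule R (SymmetricAlgebra R M) :=
  (symComponent R E n).map (symMap E).toLinearMap

theorem reesComponent_eq_pow (E : Submodule R M) (n : ℕ) :
    reesComponent E n = (E.map (SymmetricAlgebra.ι R M)) ^ n := by
  have h : (LinearMap.range (SymmetricAlgebra.ι R E)).map (symMap E).toLinearMap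
      = E.map (SymmetricAlgebra.ι R M) := by
    rw [← LinearMap.range_comp]
    have : (symMap E).toLinearMap ∘ₗ SymmetricAlgebra.ι R E
        = SymmetricAlgebra.ι R M ∘ₗ E.subtype := by
      ext x
      simp [symMap]
    rw [this, LinearMap.range_comp, Submodule.range_subtype]
  rw [reesComponent, symComponent, Submodule.map_pow, h]

theorem reesComponent_le (E : Submodule R M) (n : ℕ) :
    reesComponent E n ≤ symComponent R M n := by
  rw [reesComponent_eq_pow, symComponent]
  exact pow_le_pow_left' LinearMap.map_le_range n

/-- The quotient `R`-module `F^n / E^n`, where `F^n = Sym_n(F)`. -/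
abbrev ReesQuotient (E : Submodule R M) (n : ℕ) : Type _ :=
  symComponent R M n ⧸ (reesComponent E n).submoduleOf (symComponent R M n)

end Sym

section Multiplicity

variable {R : Type*} [CommRing R] {r : ℕ}

/-- The length `λ_R((F^n / E^n) ⊗ N)`, for `E ⊆ F = R^r`. -/
noncomputable def brLength (E : Submodule R (Fin r → R))
    (N : Type*) [AddCommGroup N] [Module R N] (n : ℕ) : ℕ∞ :=
  Module.length R (TensorProduct R (ReesQuotient E n) N)

variable (R) in
/-- The Krull dimension of `R` as a natural number (for nonzero rings of finite dimension). -/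
noncomputable def dimNat : ℕ := ((ringKrullDim R).unbotD 0).toNat

theorem coe_dimNat [IsNoetherianRing R] [IsLocalRing R] :
    (dimNat R : WithBot ℕ∞) = ringKrullDim R := by
  have h1 : ringKrullDim R ≠ ⊥ := ringKrullDim_ne_bot
  have h2 : ringKrullDim R ≠ ⊤ := ringKrullDim_ne_top
  rw [dimNat]
  generalize ringKrullDim R = x at h1 h2
  induction x with
  | bot => exact absurd rfl h1
  | coe y =>
    induction y with
    | top => exact absurd rfl h2
    | coe m => rfl

/-- The sequence `(d + r - 1)! λ((F^n / E^n) ⊗ N) / n^(d + r - 1)`, where `d = dim R`. -/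
noncomputable def brSeq (E : Submodule R (Fin r → R))
    (N : Type*) [AddCommGroup N] [Module R N] (n : ℕ) : ℝ :=
  ((dimNat R + r - 1).factorial : ℝ) * ((brLength E N n).toNat : ℝ)
    / (n : ℝ) ^ (dimNat R + r - 1)

/-- The Buchsbaum-Rim multiplicity `br(E, N)` of `E ⊆ F = R^r` on `N`. -/
noncomputable def br (E : Submodule R (Fin r → R))
    (N : Type*) [AddCommGroup N] [Module R N] : ℝ :=
  limUnder atTop (brSeq E N)

/-- `br(E, N)` is well defined: all the lengths in its definition are finite, and the sequence
defining it converges (to `br E N`). -/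
def BrDefined (E : Submodule R (Fin r → R))
    (N : Type*) [AddCommGroup N] [Module R N] : Prop :=
  (∀ n, brLength E N n ≠ ⊤) ∧ Tendsto (brSeq E N) atTop (𝓝 (br E N))

variable (R) in
/-- The set `Λ` of primes `p ∈ Supp N` with `dim R/p = dim R`. -/
def maxDimSupport (N : Type*) [AddCommGroup N] [Module R N] : Set (PrimeSpectrum R) :=
  {p | p ∈ Module.support R N ∧ ringKrullDim (R ⧸ p.asIdeal) = ringKrullDim R}

/-- The length `λ_{R_p}(N_p)`. -/
noncomputable def localLength (N : Type*) [AddCommGroup N] [Module R N] (p : PrimeSpectrum R) :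
    ℕ∞ :=
  Module.length (Localization.AtPrime p.asIdeal) (LocalizedModule.AtPrime p.asIdeal N)

end Multiplicity

end BuchsbaumRim

/-!
The multiplicity `br(E, N)` satisfies an associativity formula because `N ↦ br(E, N)` is additive on
short exact sequences and vanishes on `R/p` when `dim R/p < dim R`. A prime filtration of `N` then
leaves only the factors `R/p` with `dim R/p = dim R`, and such a `p` occurs `λ(N_p)` times, since
localization at `p` is exact and kills every other factor (`br_eq_sum`).

Everything is computed inside `W = R[X₁, …, X_r] ⊗ N`, where `Sym(F)` is the polynomial ring:
`(F^n / E^n) ⊗ N` is the quotient `F^n N / E^n N` of two submodules of `W`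
(`brLength_eq_relLength`), `E` and `F` acting as spaces of linear forms.

*The limit exists.* The length of `F^n N / E^n N` is the sum of the lengths of
`E^i F^(n-i) N / E^(i+1) F^(n-i-1) N` for `i < n`, which is the Hilbert function of a finitely
generated graded module over a polynomial ring, so it is eventually a polynomial
(`exists_polynomial_relLength_pow_smul`). As `𝔪^k F ⊆ E` for some `k`, the length is at most that
of `F^n N / 𝔪^(kn) F^n N`, and bounds on Hilbert–Samuel functions show that the degree is at most
`r - 1 + d` when `λ(N / 𝔪^t N) = O(t^d)` (`exists_reesLength_le`). With `d = dim R` this gives the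
limit; with `d = dim R/p < dim R` it gives the vanishing for `R/p`.

*Additivity.* Let `0 → N₁ → N₂ → N₃ → 0` be exact. The defect of additivity in degree `n` is the
length of `(E^n N₂ ∩ F^n N₁) / E^n N₁`. By the Artin–Rees lemma the numerator lies in
`E^(n-a) F^a N₁` for a constant `a`, so it is enough to show that, for fixed `c`, the length of
`E^i F^c N / E^(i+c) N` (`gapLength`) is of lower order than `i^(r-1+d)`, where `d = dim R` and
`E ≠ F` (`isLowerOrder_gapLength`). A prime filtration reduces this to `N = R/p`.
If `p = 𝔪`, then `E` acts through a proper subspace of `F / 𝔪F`, hence through fewer than `r`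
linear forms. If `p ≠ 𝔪`, there is `x ∈ 𝔪` that is a nonzerodivisor on `N`; a uniform Artin–Rees
lemma for the modules `E^i N` makes the function `g(t) = λ(E^i N / 𝔪^t E^i N)` almost
superadditive, so that `i g(K) ≤ g(c i)`, and `g(c i)` has order at most `i^(r-1+d)`.
-/

namespace BuchsbaumRim

/-! ### Relative length -/

section RelLength

variable {R : Type*} [CommRing R] {X Y : Type*} [AddCommGroup X] [Module R X]
  [AddCommGroup Y] [Module R Y]

/-- The length of `B / (A ∩ B)` for two submodules `A`, `B` of the same module, realised as the
length of the image of `B` in `X / A`. No inclusion between `A` and `B` is required. -/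
noncomputable def relLength (A B : Submodule R X) : ℕ∞ :=
  Module.length R (B.map A.mkQ)

theorem relLength_mono {A B C : Submodule R X} (h : B ≤ C) : relLength A B ≤ relLength A C :=
  Module.length_le_of_injective _ (Submodule.inclusion_injective (Submodule.map_mono h))

theorem relLength_map (f : X →ₗ[R] Y) (V : Submodule R Y) (U : Submodule R X) :
    relLength V (U.map f) = relLength (V.comap f) U := by
  let g : (X ⧸ V.comap f) →ₗ[R] Y ⧸ V := (V.comap f).mapQ V f le_rfl
  have hg : Function.Injective g := by
    rw [← LinearMap.ker_eq_bot, Submodule.ker_mapQ]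
    simp
  have h : (U.map f).map V.mkQ = (U.map (V.comap f).mkQ).map g := by
    rw [← Submodule.map_comp, ← Submodule.map_comp]
    rfl
  rw [relLength, relLength, h]
  exact ((U.map (V.comap f).mkQ).equivMapOfInjective g hg).length_eq.symm

/-- Additivity along `A ≤ B`, without the hypothesis `B ≤ C`. -/
theorem relLength_eq_add {A B : Submodule R X} (h : A ≤ B) (C : Submodule R X) :
    relLength A C = relLength A (B ⊓ C) + relLength B C := by
  let g : (X ⧸ A) →ₗ[R] X ⧸ B := Submodule.factor h
  have hmem : ∀ x ∈ C.map A.mkQ, g x ∈ C.map B.mkQ := by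
    rintro _ ⟨x, hx, rfl⟩
    exact ⟨x, hx, rfl⟩
  refine Module.length_eq_add_of_exact
    (Submodule.inclusion (Submodule.map_mono inf_le_right : (B ⊓ C).map A.mkQ ≤ C.map A.mkQ))
    (g.restrict hmem) (Submodule.inclusion_injective _) ?_ ?_
  · rintro ⟨_, x, hx, rfl⟩
    exact ⟨⟨A.mkQ x, x, hx, rfl⟩, rfl⟩
  · rintro ⟨_, x, hx, rfl⟩
    constructor
    · intro h0
      have : B.mkQ x = 0 := congrArg Subtype.val h0
      rw [Submodule.mkQ_apply, Submodule.Quotient.mk_eq_zero] at this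
      exact ⟨⟨A.mkQ x, x, ⟨this, hx⟩, rfl⟩, rfl⟩
    · rintro ⟨⟨_, y, hy, rfl⟩, h1⟩
      have h1 : A.mkQ y = A.mkQ x := congrArg Subtype.val h1
      apply Subtype.ext
      change g (A.mkQ x) = 0
      rw [← h1]
      exact (Submodule.Quotient.mk_eq_zero B).2 hy.1

theorem relLength_add {A B C : Submodule R X} (h : A ≤ B) (h' : B ≤ C) :
    relLength A C = relLength A B + relLength B C := by
  rw [relLength_eq_add h, inf_eq_left.2 h']

theorem relLength_anti {A B C : Submodule R X} (h : A ≤ B) : relLength B C ≤ relLength A C := by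
  rw [relLength_eq_add h]
  exact le_add_self

theorem relLength_sup (A B : Submodule R X) : relLength A (A ⊔ B) = relLength A B := by
  rw [relLength, Submodule.map_sup, Submodule.mkQ_map_self, bot_sup_eq, relLength]

theorem relLength_eq_zero {A B : Submodule R X} (h : B ≤ A) : relLength A B = 0 := by
  rw [relLength, Module.length_eq_zero_iff, Submodule.subsingleton_iff_eq_bot, eq_bot_iff]
  rw [Submodule.map_le_iff_le_comap]
  simpa using h

theorem relLength_inf (A B : Submodule R X) : relLength (A ⊓ B) B = relLength A B := by
  rw [relLength_eq_add (inf_le_left : A ⊓ B ≤ A), relLength_eq_zero le_rfl, zero_add]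

theorem relLength_top (A : Submodule R X) : relLength A ⊤ = Module.length R (X ⧸ A) := by
  rw [relLength, Submodule.map_top, Submodule.range_mkQ, Module.length_top]

theorem relLength_map_map_of_injective {f : X →ₗ[R] Y} (hf : Function.Injective f)
    (A B : Submodule R X) : relLength (A.map f) (B.map f) = relLength A B := by
  rw [relLength_map, Submodule.comap_map_eq_of_injective hf]

theorem relLength_map_map_le (f : X →ₗ[R] Y) (A B : Submodule R X) :
    relLength (A.map f) (B.map f) ≤ relLength A B := by
  rw [relLength_map]
  exact relLength_anti (Submodule.le_comap_map f A)

end RelLength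

/-! ### Hilbert polynomials of families of submodules -/

section HilbertPolynomial

/-- Every polynomial is a forward difference: for monomials this is the difference equation
`B_(m+1)(n + 1) - B_(m+1)(n) = (m + 1) n^m` of the Bernoulli polynomials. -/
theorem exists_polynomial_forward_difference (p : Polynomial ℚ) :
    ∃ q : Polynomial ℚ, ∀ n : ℕ, q.eval ((n : ℚ) + 1) - q.eval (n : ℚ) = p.eval (n : ℚ) := by
  induction p using Polynomial.induction_on' with
  | add p₁ p₂ h₁ h₂ =>
    obtain ⟨q₁, hq₁⟩ := h₁
    obtain ⟨q₂, hq₂⟩ := h₂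
    refine ⟨q₁ + q₂, fun n => ?_⟩
    rw [Polynomial.eval_add, Polynomial.eval_add, Polynomial.eval_add, ← hq₁, ← hq₂]
    ring
  | monomial m a =>
    refine ⟨Polynomial.C (a / (m + 1)) * Polynomial.bernoulli (m + 1), fun n => ?_⟩
    have h := Polynomial.bernoulli_eval_one_add (m + 1) (n : ℚ)
    rw [add_comm (1 : ℚ)] at h
    have hm : (m : ℚ) + 1 ≠ 0 := by positivity
    simp only [Polynomial.eval_mul, Polynomial.eval_C, h, Polynomial.eval_monomial]
    push_cast
    field_simp
    ring

theorem eventually_polynomial_of_forward_difference {f : ℕ → ℚ} {p : Polynomial ℚ}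
    (h : ∀ᶠ n : ℕ in atTop, f (n + 1) - f n = p.eval (n : ℚ)) :
    ∃ q : Polynomial ℚ, ∀ᶠ n : ℕ in atTop, f n = q.eval (n : ℚ) := by
  obtain ⟨q, hq⟩ := exists_polynomial_forward_difference p
  obtain ⟨n₀, hn₀⟩ := eventually_atTop.1 h
  refine ⟨q + Polynomial.C (f n₀ - q.eval (n₀ : ℚ)), eventually_atTop.2 ⟨n₀, fun n hn => ?_⟩⟩
  induction n, hn using Nat.le_induction with
  | base => simp
  | succ n hn ih =>
    have h1 := hn₀ n hn
    have h2 := hq n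
    rw [Polynomial.eval_add, Polynomial.eval_C] at ih ⊢
    push_cast
    linarith

variable {R : Type*} [CommRing R] {X : Type*} [AddCommGroup X] [Module R X]

/-- The families `L` of submodules of `X`, indexed by a degree `n`, that are graded modules over
the polynomial ring on the operators in `s`, each of which has degree one. -/
def IsStable (s : Set (Module.End R X)) (L : ℕ → Submodule R X) : Prop :=
  ∀ x ∈ s, ∀ n, (L n).map x ≤ L (n + 1)

/-- The Noetherian property of the graded subquotient `⨁ U n / V n`, over the polynomial ring on
the operators in `s`: every graded submodule is generated in bounded degrees. -/
def IsNoetherianFamily (s : Set (Module.End R X)) (V U : ℕ → Submodule R X) : Prop :=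
  ∀ L : ℕ → Submodule R X, V ≤ L → L ≤ U → IsStable s L →
    ∀ᶠ n in atTop, L (n + 1) ≤ (⨆ x ∈ s, (L n).map x) ⊔ V (n + 1)

/-- **Hilbert's theorem**: if `⨁ U n / V n` is Noetherian over the polynomial ring on finitely many
commuting operators of degree one, then the length of `U n / V n` is a polynomial in `n` for
large `n`. The induction on the number of operators compares kernel and cokernel of one of them,
both of which are subquotients of the same ambient module `X`. -/
theorem exists_hilbertPolynomial {s : Set (Module.End R X)} (hs : s.Finite)
    (hcomm : ∀ x ∈ s, ∀ y ∈ s, Commute x y) (V U : ℕ → Submodule R X) (hVU : V ≤ U)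
    (hV : IsStable s V) (hU : IsStable s U) (hN : IsNoetherianFamily s V U)
    (hfin : ∀ n, relLength (V n) (U n) ≠ ⊤) :
    ∃ p : Polynomial ℚ, ∀ᶠ n : ℕ in atTop,
      ((relLength (V n) (U n)).toNat : ℚ) = p.eval (n : ℚ) := by
  induction s, hs using Set.Finite.induction_on generalizing V U with
  | empty =>
    refine ⟨0, ?_⟩
    have h := hN U hVU le_rfl hU
    obtain ⟨n₀, hn₀⟩ := eventually_atTop.1 h
    refine eventually_atTop.2 ⟨n₀ + 1, fun n hn => ?_⟩
    obtain ⟨m, rfl⟩ : ∃ m, n = m + 1 := ⟨n - 1, by omega⟩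
    have h1 := hn₀ m (by omega)
    simp only [Set.mem_empty_iff_false, iSup_false, iSup_bot, bot_sup_eq] at h1
    simp [relLength_eq_zero h1]
  | @insert a s ha hs ih =>
    have ha' : a ∈ insert a s := Set.mem_insert a s
    -- `K n / V n` is the kernel and `U (n + 1) / C n` the cokernel of the map induced by `a` from
    -- `U n / V n` to `U (n + 1) / V (n + 1)`. Both are killed by `a`, so `s` suffices for them.
    let K : ℕ → Submodule R X := fun n => U n ⊓ (V (n + 1)).comap a
    let C : ℕ → Submodule R X := fun n => (U n).map a ⊔ V (n + 1)
    have hVK : V ≤ K := fun n => le_inf (hVU n) (Submodule.map_le_iff_le_comap.1 (hV a ha' n))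
    have hKU : K ≤ U := fun n => inf_le_left
    have hCU : ∀ n, C n ≤ U (n + 1) := fun n => sup_le (hU a ha' n) (hVU (n + 1))
    have hcomm' : ∀ x ∈ s, ∀ y ∈ s, Commute x y := fun x hx y hy =>
      hcomm x (Set.mem_insert_of_mem a hx) y (Set.mem_insert_of_mem a hy)
    have hsa : ∀ x ∈ s, ∀ u, x (a u) = a (x u) := fun x hx u =>
      LinearMap.congr_fun (hcomm x (Set.mem_insert_of_mem a hx) a ha') u
    have hV' : IsStable s V := fun x hx => hV x (Set.mem_insert_of_mem a hx)
    have hU' : IsStable s U := fun x hx => hU x (Set.mem_insert_of_mem a hx)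
    have hK : IsStable s K := by
      rintro x hx n _ ⟨u, ⟨hu, hau⟩, rfl⟩
      refine ⟨hU' x hx n ⟨u, hu, rfl⟩, ?_⟩
      change a (x u) ∈ V (n + 1 + 1)
      rw [← hsa x hx]
      exact hV' x hx (n + 1) ⟨a u, hau, rfl⟩
    have hC : IsStable s C := by
      intro x hx n
      rw [Submodule.map_sup]
      refine sup_le_sup ?_ (hV' x hx (n + 1))
      rintro _ ⟨_, ⟨u, hu, rfl⟩, rfl⟩
      exact ⟨x u, hU' x hx n ⟨u, hu, rfl⟩, (hsa x hx u).symm⟩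
    have hadd : ∀ n, relLength (V n) (U n) = relLength (V n) (K n) +
        relLength (V (n + 1)) (C n) := by
      intro n
      rw [relLength_add (hVK n) (hKU n)]
      congr 1
      rw [show C n = V (n + 1) ⊔ (U n).map a from sup_comm _ _, relLength_sup, relLength_map,
        show K n = (V (n + 1)).comap a ⊓ U n from inf_comm _ _, relLength_inf]
    have hadd' : ∀ n, relLength (V (n + 1)) (U (n + 1)) = relLength (V (n + 1)) (C n) +
        relLength (C n) (U (n + 1)) := fun n => relLength_add le_sup_right (hCU n)
    have hfK : ∀ n, relLength (V n) (K n) ≠ ⊤ := fun n =>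
      ne_top_of_le_ne_top (hfin n) (relLength_mono (hKU n))
    have hfC : ∀ n, relLength (C n) (U (n + 1)) ≠ ⊤ := fun n =>
      ne_top_of_le_ne_top (hfin (n + 1)) (relLength_anti le_sup_right)
    have hfVC : ∀ n, relLength (V (n + 1)) (C n) ≠ ⊤ := fun n =>
      ne_top_of_le_ne_top (hfin (n + 1)) (relLength_mono (hCU n))
    obtain ⟨p, hp⟩ := ih hcomm' V K hVK hV' hK (by
      intro L hVL hLK hL
      have hLa : IsStable (insert a s) L := by
        rintro x (rfl | hx) n
        · exact (Submodule.map_le_iff_le_comap.2 ((hLK n).trans inf_le_right)).trans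
            (hVL (n + 1))
        · exact hL x hx n
      filter_upwards [hN L hVL (hLK.trans hKU) hLa] with n hn
      refine hn.trans ?_
      rw [iSup_insert]
      refine sup_le (sup_le (le_sup_of_le_right ?_) le_sup_left) le_sup_right
      exact Submodule.map_le_iff_le_comap.2 ((hLK n).trans inf_le_right)) hfK
    obtain ⟨q, hq⟩ := ih hcomm' C (fun n => U (n + 1)) hCU hC (fun x hx n => hU' x hx (n + 1)) (by
      intro L hCL hLU hL
      -- The cokernel lives in degrees `n + 1`, so `L` is shifted, with nothing new in degree `0`.
      let L' : ℕ → Submodule R X := fun n => Nat.casesOn n (V 0) L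
      have hVL' : V ≤ L' := by
        rintro (_ | n)
        · exact le_rfl
        · exact le_sup_right.trans (hCL n)
      have hLU' : L' ≤ U := by
        rintro (_ | n)
        · exact hVU 0
        · exact hLU n
      have hL' : IsStable (insert a s) L' := by
        rintro x hx (_ | n)
        · exact (hV x hx 0).trans (hVL' 1)
        · rcases hx with rfl | hx
          · exact (Submodule.map_mono (hLU n)).trans (le_sup_left.trans (hCL (n + 1)))
          · exact hL x hx n
      have h := (tendsto_add_atTop_nat 1).eventually (hN L' hVL' hLU' hL')
      filter_upwards [h] with n hn
      refine hn.trans ?_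
      rw [iSup_insert]
      refine sup_le (sup_le (le_sup_of_le_right ?_) le_sup_left) ?_
      · exact (Submodule.map_mono (hLU n)).trans le_sup_left
      · exact le_sup_of_le_right le_sup_right) hfC
    refine eventually_polynomial_of_forward_difference (p := q - p) ?_
    filter_upwards [hp, hq] with n hpn hqn
    rw [hadd' n, hadd n, ENat.toNat_add (hfVC n) (hfC n), ENat.toNat_add (hfK n) (hfVC n),
      Polynomial.eval_sub, ← hpn, ← hqn]
    push_cast
    ring

variable (X) in
/-- The operator `x`, regarded as an operator of degree one on the graded module `⨁ X`. -/
noncomputable def shiftOperator (x : Module.End R X) : Module.End R (ℕ →₀ X) :=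
  Finsupp.lmapDomain X R Nat.succ ∘ₗ Finsupp.mapRange.linearMap x

theorem shiftOperator_single (x : Module.End R X) (n : ℕ) (u : X) :
    shiftOperator X x (Finsupp.single n u) = Finsupp.single (n + 1) (x u) := by
  simp [shiftOperator, Finsupp.mapDomain_single]

theorem shiftOperator_apply_zero (x : Module.End R X) (f : ℕ →₀ X) :
    shiftOperator X x f 0 = 0 := by
  rw [shiftOperator, LinearMap.comp_apply, Finsupp.lmapDomain_apply]
  exact Finsupp.mapDomain_of_notMem_range _ _ (by simp)

theorem shiftOperator_apply_succ (x : Module.End R X) (f : ℕ →₀ X) (n : ℕ) :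
    shiftOperator X x f (n + 1) = x (f n) := by
  rw [shiftOperator, LinearMap.comp_apply, Finsupp.lmapDomain_apply]
  exact Finsupp.mapDomain_apply Nat.succ_injective _ _

theorem isNoetherianRing_adjoin_shiftOperator [IsNoetherianRing R] {s : Set (Module.End R X)}
    (hs : s.Finite) (hcomm : ∀ x ∈ s, ∀ y ∈ s, Commute x y) :
    IsNoetherianRing (Algebra.adjoin R (shiftOperator X '' s)) := by
  have h : ∀ a ∈ shiftOperator X '' s, ∀ b ∈ shiftOperator X '' s, a * b = b * a := by
    rintro _ ⟨x, hx, rfl⟩ _ ⟨y, hy, rfl⟩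
    refine Finsupp.lhom_ext fun n u => ?_
    simp only [Module.End.mul_apply, shiftOperator_single]
    rw [← Module.End.mul_apply, (hcomm x hx y hy).eq, Module.End.mul_apply]
  have hmul := Algebra.isMulCommutative_adjoin R h
  let _ : CommRing (Algebra.adjoin R (shiftOperator X '' s)) :=
    { (Algebra.adjoin R (shiftOperator X '' s)).toRing with mul_comm := hmul.is_comm.comm }
  have hfin : ((↑) ⁻¹' (shiftOperator X '' s) :
      Set (Algebra.adjoin R (shiftOperator X '' s))).Finite :=
    (hs.image _).preimage Subtype.val_injective.injOn
  have : Algebra.FiniteType R (Algebra.adjoin R (shiftOperator X '' s)) :=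
    ⟨⟨hfin.toFinset, by rw [Set.Finite.coe_toFinset, Algebra.adjoin_adjoin_coe_preimage]⟩⟩
  exact Algebra.FiniteType.isNoetherianRing R (Algebra.adjoin R (shiftOperator X '' s))

/-- A stable family of submodules as a module over the algebra of operators. -/
noncomputable def totalSubmodule {s : Set (Module.End R X)} {L : ℕ → Submodule R X}
    (hL : IsStable s L) : Submodule (Algebra.adjoin R (shiftOperator X '' s)) (ℕ →₀ X) where
  carrier := {f | ∀ n, f n ∈ L n}
  add_mem' hf hg n := (L n).add_mem (hf n) (hg n)
  zero_mem' n := (L n).zero_mem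
  smul_mem' := by
    rintro ⟨t, ht⟩ f hf
    change ∀ n, f n ∈ L n at hf
    change ∀ n, t f n ∈ L n
    induction ht using Algebra.adjoin_induction generalizing f with
    | mem t ht =>
      obtain ⟨x, hx, rfl⟩ := ht
      rintro (_ | n)
      · rw [shiftOperator_apply_zero]
        exact (L 0).zero_mem
      · rw [shiftOperator_apply_succ]
        exact hL x hx n ⟨f n, hf n, rfl⟩
    | algebraMap a => exact fun n => (L n).smul_mem a (hf n)
    | add t₁ t₂ _ _ h₁ h₂ => exact fun n => (L n).add_mem (h₁ hf n) (h₂ hf n)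
    | mul t₁ t₂ _ _ h₁ h₂ => exact h₁ (h₂ hf)

theorem single_mem_totalSubmodule {s : Set (Module.End R X)} {L : ℕ → Submodule R X}
    (hL : IsStable s L) {n : ℕ} {u : X} (hu : u ∈ L n) :
    Finsupp.single n u ∈ totalSubmodule hL := by
  intro m
  by_cases h : m = n
  · subst h
    simpa using hu
  · rw [Finsupp.single_eq_of_ne h]
    exact (L m).zero_mem

theorem totalSubmodule_fg {s : Set (Module.End R X)} {U : ℕ → Submodule R X}
    (hU : IsStable s U) (hfg : ∀ n, (U n).FG)
    (hgen : ∀ᶠ n in atTop, U (n + 1) ≤ ⨆ x ∈ s, (U n).map x) : (totalSubmodule hU).FG := by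
  obtain ⟨n₀, hn₀⟩ := eventually_atTop.1 hgen
  choose G hG using hfg
  let S : Set (ℕ →₀ X) := ⋃ n ∈ Set.Iic n₀, Finsupp.single n '' (G n : Set X)
  refine ⟨Set.Finite.toFinset (s := S)
    ((Set.finite_Iic n₀).biUnion fun n _ => (G n).finite_toSet.image _), ?_⟩
  rw [Set.Finite.coe_toFinset]
  refine le_antisymm (Submodule.span_le.2 ?_) ?_
  · refine Set.iUnion₂_subset fun n _ => ?_
    rintro _ ⟨u, hu, rfl⟩
    exact single_mem_totalSubmodule hU (hG n ▸ Submodule.subset_span hu)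
  · set P := Submodule.span (Algebra.adjoin R (shiftOperator X '' s)) S with hP
    have key : ∀ n, U n ≤ (P.restrictScalars R).comap (Finsupp.lsingle n) := by
      intro n
      induction n with
      | zero =>
        rw [← hG 0, Submodule.span_le]
        exact fun u hu => Submodule.subset_span
          (Set.mem_biUnion (Set.mem_Iic.2 (Nat.zero_le n₀)) ⟨u, hu, rfl⟩)
      | succ n ih =>
        rcases le_or_gt (n + 1) n₀ with h | h
        · rw [← hG (n + 1), Submodule.span_le]
          exact fun u hu => Submodule.subset_span (Set.mem_biUnion (Set.mem_Iic.2 h) ⟨u, hu, rfl⟩)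
        · refine (hn₀ n (by omega)).trans (iSup₂_le fun x hx => ?_)
          rintro _ ⟨u, hu, rfl⟩
          have h1 := P.smul_mem (⟨shiftOperator X x, Algebra.subset_adjoin ⟨x, hx, rfl⟩⟩ :
            Algebra.adjoin R (shiftOperator X '' s)) (ih hu)
          change Finsupp.single (n + 1) (x u) ∈ P
          rw [← shiftOperator_single]
          exact h1
    intro f hf
    rw [← f.sum_single]
    exact P.sum_mem fun n _ => key n (hf n)

/-- **Hilbert's basis theorem** for families of submodules: a graded module that is finitely
generated over the Noetherian algebra of operators, and hence each of its quotients, is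
Noetherian. -/
theorem isNoetherianFamily_of_fg [IsNoetherianRing R] {s : Set (Module.End R X)} (hs : s.Finite)
    (hcomm : ∀ x ∈ s, ∀ y ∈ s, Commute x y) {V U : ℕ → Submodule R X}
    (hU : IsStable s U) (hfg : ∀ n, (U n).FG)
    (hgen : ∀ᶠ n in atTop, U (n + 1) ≤ ⨆ x ∈ s, (U n).map x) : IsNoetherianFamily s V U := by
  intro L _ hLU hL
  have := isNoetherianRing_adjoin_shiftOperator hs hcomm
  have hnoeth : IsNoetherian (Algebra.adjoin R (shiftOperator X '' s)) (totalSubmodule hU) :=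
    isNoetherian_of_fg_of_noetherian (R := Algebra.adjoin R (shiftOperator X '' s))
      (M := ℕ →₀ X) (totalSubmodule hU) (totalSubmodule_fg hU hfg hgen)
  obtain ⟨G, hG⟩ := isNoetherian_submodule.1 hnoeth (totalSubmodule hL)
    fun f hf n => hLU n (hf n)
  obtain ⟨N, hN⟩ : ∃ N, ∀ f ∈ G, ∀ n, N < n → f n = 0 := by
    refine ⟨G.sup fun f => f.support.sup id, fun f hf n hn => ?_⟩
    by_contra h
    have h1 : n ≤ f.support.sup id := Finset.le_sup (f := id) (Finsupp.mem_support_iff.2 h)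
    have h2 : f.support.sup id ≤ G.sup fun f => f.support.sup id :=
      Finset.le_sup (f := fun f : ℕ →₀ X => f.support.sup id) hf
    omega
  -- The graded submodule of `L` generated by the part of degree at most `N`.
  let L' : ℕ → Submodule R X := fun n =>
    if n ≤ N then L n else ⨆ x ∈ s, (L (n - 1)).map x
  have hL'L : L' ≤ L := by
    intro n
    by_cases h : n ≤ N
    · simp [L', h]
    · obtain ⟨m, rfl⟩ : ∃ m, n = m + 1 := ⟨n - 1, by omega⟩
      simp only [L', h, if_false]
      exact iSup₂_le fun x hx => hL x hx m
  have hL' : IsStable s L' := by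
    intro x hx n
    refine (Submodule.map_mono (hL'L n)).trans ?_
    by_cases h : n + 1 ≤ N
    · simpa [L', h] using hL x hx n
    · simp only [L', h, if_false, Nat.add_sub_cancel]
      exact le_iSup₂ (f := fun x (_ : x ∈ s) => (L n).map x) x hx
  have hle : totalSubmodule hL ≤ totalSubmodule hL' := by
    rw [← hG, Submodule.span_le]
    intro f hf n
    by_cases h : n ≤ N
    · have h1 : f ∈ totalSubmodule hL := hG ▸ Submodule.subset_span hf
      simpa [L', h] using h1 n
    · rw [hN f hf n (by omega)]
      exact (L' n).zero_mem
  refine eventually_atTop.2 ⟨N, fun n hn u hu => Submodule.mem_sup_left ?_⟩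
  have h1 := hle (single_mem_totalSubmodule hL hu) (n + 1)
  simpa [L', show ¬ n + 1 ≤ N by omega] using h1

end HilbertPolynomial

/-! ### Counting generators -/

section Generators

variable {R : Type*} [CommRing R] {B : Type*} [CommRing B] [Algebra R B]
  {W : Type*} [AddCommGroup W] [Module R W] [Module B W] [IsScalarTower R B W]

theorem relLength_sup_le (A B C : Submodule R W) :
    relLength A (B ⊔ C) ≤ relLength A B + relLength A C := by
  rw [← relLength_sup A (B ⊔ C), relLength_add le_sup_left
    (sup_le_sup_left le_sup_left A : A ⊔ B ≤ A ⊔ (B ⊔ C)), relLength_sup]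
  gcongr
  refine le_trans ?_ (relLength_anti (le_sup_left : A ≤ A ⊔ B))
  rw [← sup_assoc, relLength_sup]

theorem relLength_iSup_le {ι : Type*} [Fintype ι] (A : Submodule R W) (C : ι → Submodule R W)
    {b : ℕ∞} (h : ∀ i, relLength A (C i) ≤ b) :
    relLength A (⨆ i, C i) ≤ Fintype.card ι * b := by
  classical
  have key : ∀ s : Finset ι, relLength A (s.sup C) ≤ s.card * b := by
    intro s
    induction s using Finset.induction_on with
    | empty => simp [relLength_eq_zero]
    | insert i s hi ih =>
      rw [Finset.sup_insert, Finset.card_insert_of_notMem hi]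
      refine (relLength_sup_le _ _ _).trans ?_
      push_cast
      rw [add_mul, one_mul, add_comm]
      exact add_le_add ih (h i)
  simpa [Finset.sup_univ_eq_iSup] using key Finset.univ

theorem smul_le_iSup_map_lsmul {ι : Type*} {P : Submodule R B} {g : ι → B}
    (hP : P ≤ Submodule.span R (Set.range g)) (V : Submodule R W) :
    P • V ≤ ⨆ i, V.map (Algebra.lsmul R R W (g i)) := by
  rw [Submodule.smul_le]
  intro p hp v hv
  replace hp := hP hp
  induction hp using Submodule.span_induction with
  | mem b hb =>
    obtain ⟨i, rfl⟩ := hb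
    exact Submodule.mem_iSup_of_mem i ⟨v, hv, rfl⟩
  | zero => simp
  | add b c _ _ hb hc =>
    rw [add_smul]
    exact add_mem hb hc
  | smul a b _ hb =>
    rw [smul_assoc]
    exact Submodule.smul_mem _ a hb

theorem map_lsmul_smul (b : B) (J : Submodule R B) (V : Submodule R W) :
    (J • V).map (Algebra.lsmul R R W b) = J • V.map (Algebra.lsmul R R W b) := by
  refine le_antisymm ?_ ?_
  · rw [Submodule.map_le_iff_le_comap, Submodule.smul_le]
    intro j hj v hv
    change b • j • v ∈ J • V.map (Algebra.lsmul R R W b)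
    rw [smul_comm]
    have h : b • v ∈ V.map (Algebra.lsmul R R W b) := ⟨v, hv, rfl⟩
    exact Submodule.smul_mem_smul hj h
  · rw [Submodule.smul_le]
    rintro j hj _ ⟨v, hv, rfl⟩
    exact ⟨j • v, Submodule.smul_mem_smul hj hv, smul_comm b j v⟩

/-- If `P` is generated by `card ι` elements, then `P • V` is a sum of `card ι` images of `V`. -/
theorem relLength_smul_smul_le {ι : Type*} [Fintype ι] {P : Submodule R B} {g : ι → B}
    (hP : P = Submodule.span R (Set.range g)) (J : Submodule R B) (V : Submodule R W) :
    relLength (J • P • V) (P • V) ≤ Fintype.card ι * relLength (J • V) V := by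
  refine (relLength_mono (smul_le_iSup_map_lsmul hP.le V)).trans
    (relLength_iSup_le _ _ fun i => ?_)
  refine le_trans (relLength_anti ?_) (relLength_map_map_le (Algebra.lsmul R R W (g i)) _ _)
  rw [map_lsmul_smul]
  refine Submodule.smul_mono le_rfl ?_
  rintro _ ⟨v, hv, rfl⟩
  exact Submodule.smul_mem_smul (hP ▸ Submodule.subset_span ⟨i, rfl⟩) hv

theorem span_range_pow {ι : Type*} (g : ι → B) (n : ℕ) :
    Submodule.span R (Set.range g) ^ n =
      Submodule.span R (Set.range fun m : Sym ι n => ((m : Multiset ι).map g).prod) := by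
  induction n with
  | zero =>
    rw [pow_zero, Submodule.one_eq_span]
    congr 1
    ext x
    simp [Subsingleton.elim _ (Sym.nil : Sym ι 0)]
  | succ n ih =>
    rw [pow_succ, ih, Submodule.span_mul_span]
    congr 1
    ext x
    constructor
    · rintro ⟨_, ⟨m, rfl⟩, _, ⟨i, rfl⟩, rfl⟩
      exact ⟨i ::ₛ m, by simp [Sym.coe_cons, mul_comm]⟩
    · rintro ⟨m, rfl⟩
      obtain ⟨i, m, rfl⟩ := m.exists_eq_cons_of_succ
      exact ⟨_, ⟨m, rfl⟩, _, ⟨i, rfl⟩, by simp [Sym.coe_cons, mul_comm]⟩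

/-- The power `P ^ n` is generated by the monomials of degree `n` in the generators of `P`. -/
theorem relLength_smul_pow_smul_le {ι : Type*} [Fintype ι] {P : Submodule R B} {g : ι → B}
    (hP : P = Submodule.span R (Set.range g)) (n : ℕ) (J : Submodule R B) (V : Submodule R W) :
    relLength (J • P ^ n • V) (P ^ n • V) ≤
      (Nat.multichoose (Fintype.card ι) n : ℕ) * relLength (J • V) V := by
  classical
  rw [← Sym.card_sym_eq_multichoose]
  exact relLength_smul_smul_le (by rw [hP, span_range_pow]) J V

/-- For `s = 0` the truncated exponent is `0`, and `multichoose 0 n ≤ 1` holds as well. -/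
theorem multichoose_le_pow (s n : ℕ) : Nat.multichoose s n ≤ (s + n) ^ (s - 1) := by
  rcases s with _ | s
  · rcases n with _ | n <;> simp
  · rw [Nat.multichoose_eq, ← Nat.choose_symm (by omega)]
    refine (Nat.choose_le_pow _ _).trans ?_
    rw [show s + 1 + n - 1 - n = s + 1 - 1 by omega]
    exact Nat.pow_le_pow_left (by omega) _

theorem sum_multichoose_le (s n : ℕ) :
    ∑ i ∈ Finset.range n, Nat.multichoose s i ≤ (s + n) ^ s := by
  have h : ∀ n, ∑ i ∈ Finset.range (n + 1), Nat.multichoose s i = Nat.multichoose (s + 1) n := by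
    intro n
    induction n with
    | zero => simp
    | succ n ih => rw [Finset.sum_range_succ, ih, Nat.multichoose_succ_succ, add_comm]
  rcases n with _ | n
  · simp
  · rw [h]
    refine (multichoose_le_pow _ _).trans (le_of_eq ?_)
    rw [add_tsub_cancel_right]
    congr 1
    omega

end Generators

/-! ### Hilbert–Samuel functions -/

section HilbertSamuel

open IsLocalRing

variable {R : Type*} [CommRing R]

/-- The Hilbert–Samuel function of an ideal with `s` generators is `O(t^s)`: the filtration by the
powers of the ideal `q` has factors `q^i M / q^(i+1) M`, each a sum of `multichoose s i` images of
`M / q M`. -/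
theorem relLength_smul_pow_top_le {M : Type*} [AddCommGroup M] [Module R M] {ι : Type*} [Fintype ι]
    (y : ι → R) (t : ℕ) :
    relLength (Ideal.span (Set.range y) ^ t • (⊤ : Submodule R M)) ⊤ ≤
      ((Fintype.card ι + t) ^ Fintype.card ι : ℕ) *
        relLength (Ideal.span (Set.range y) • (⊤ : Submodule R M)) ⊤ := by
  set q := Ideal.span (Set.range y) with hq
  have h : relLength (q ^ t • (⊤ : Submodule R M)) ⊤ ≤
      (∑ i ∈ Finset.range t, Nat.multichoose (Fintype.card ι) i : ℕ) *
        relLength (q • (⊤ : Submodule R M)) ⊤ := by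
    induction t with
    | zero => simp [relLength_eq_zero]
    | succ t ih =>
      have h1 : q ^ (t + 1) • (⊤ : Submodule R M) = q • q ^ t • ⊤ := by
        rw [pow_succ', mul_smul]
      rw [Finset.sum_range_succ,
        relLength_add (B := q ^ t • ⊤) (h1 ▸ Submodule.smul_le_right) le_top,
        Nat.cast_add, add_mul, add_comm, h1]
      exact add_le_add ih (relLength_smul_pow_smul_le (B := R) hq t q ⊤)
  refine h.trans ?_
  gcongr
  exact_mod_cast sum_multichoose_le _ t

theorem relLength_smul_top_le_of_exact {M₁ M₂ M₃ : Type*} [AddCommGroup M₁] [Module R M₁]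
    [AddCommGroup M₂] [Module R M₂] [AddCommGroup M₃] [Module R M₃] {f : M₁ →ₗ[R] M₂}
    {g : M₂ →ₗ[R] M₃} (hg : Function.Surjective g) (hfg : Function.Exact f g) (I : Ideal R) :
    relLength (I • (⊤ : Submodule R M₂)) ⊤ ≤
      relLength (I • (⊤ : Submodule R M₁)) ⊤ + relLength (I • (⊤ : Submodule R M₃)) ⊤ := by
  have hg' : LinearMap.range g = ⊤ := LinearMap.range_eq_top.2 hg
  rw [relLength_add (B := I • ⊤ ⊔ LinearMap.range f) le_sup_left le_top]
  refine add_le_add ?_ (le_of_eq ?_)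
  · rw [relLength_sup, LinearMap.range_eq_map]
    refine le_trans (relLength_anti ?_) (relLength_map_map_le f _ _)
    rw [Submodule.map_smul'']
    exact Submodule.smul_mono le_rfl le_top
  · have h1 : I • (⊤ : Submodule R M₃) = (I • (⊤ : Submodule R M₂)).map g := by
      rw [Submodule.map_smul'', Submodule.map_top, hg']
    have h2 : (⊤ : Submodule R M₃) = (⊤ : Submodule R M₂).map g := by rw [Submodule.map_top, hg']
    rw [h1, ← LinearMap.exact_iff.1 hfg, ← Submodule.comap_map_eq, ← relLength_map, ← h2]

variable [IsNoetherianRing R] [IsLocalRing R]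

/-- The Hilbert–Samuel function of `R / p` is bounded by a polynomial of degree `dim R / p`: it is
at most the Hilbert–Samuel function of an ideal generated by a system of parameters. -/
theorem exists_relLength_pow_le_of_prime (p : Ideal R) [p.IsPrime] {e : ℕ}
    (he : ringKrullDim (R ⧸ p) ≤ e) :
    ∃ C : ℕ, ∀ t, relLength (maximalIdeal R ^ t • (⊤ : Submodule R (R ⧸ p))) ⊤ ≤
      (C * (t + 1) ^ e : ℕ) := by
  have : IsLocalRing (R ⧸ p) :=
    IsLocalRing.of_surjective' (Ideal.Quotient.mk p) Ideal.Quotient.mk_surjective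
  have hmap : (maximalIdeal R).map (Ideal.Quotient.mk p) = maximalIdeal (R ⧸ p) := by
    have := IsLocalHom.of_surjective (Ideal.Quotient.mk p) Ideal.Quotient.mk_surjective
    ext x
    obtain ⟨x, rfl⟩ := Ideal.Quotient.mk_surjective x
    simp [sup_eq_left.mpr (le_maximalIdeal (Ideal.IsPrime.ne_top ‹p.IsPrime›))]
  obtain ⟨s, hs, hcard⟩ :=
    Ideal.exists_finset_card_eq_height_of_isNoetherianRing (maximalIdeal (R ⧸ p))
  have hse : s.card ≤ e := by
    have h1 := IsLocalRing.maximalIdeal_height_eq_ringKrullDim (R := R ⧸ p)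
    rw [← hcard] at h1
    rw [← h1] at he
    exact_mod_cast he
  -- The system of parameters `s` of `R / p` is lifted to an ideal `q` of `R`, so that all lengths
  -- are lengths of `R`-modules. Then `𝔪^a ⊆ q + p` for some `a`.
  choose y hy using fun b : s => Ideal.Quotient.mk_surjective (I := p) b.1
  set q := Ideal.span (Set.range y) with hq
  have hqs : q.map (Ideal.Quotient.mk p) = Ideal.span (s : Set (R ⧸ p)) := by
    rw [hq, Ideal.map_span, ← Set.range_comp]
    congr 1
    ext x
    simp [hy]
  have hqm : q ≤ maximalIdeal R := by
    refine le_maximalIdeal fun h => ?_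
    rw [h, Ideal.map_top] at hqs
    have := hs.1.2
    rw [← hqs] at this
    exact (maximalIdeal.isMaximal (R ⧸ p)).ne_top (top_le_iff.1 this)
  obtain ⟨a, ha⟩ : ∃ a, maximalIdeal (R ⧸ p) ^ a ≤ Ideal.span (s : Set (R ⧸ p)) := by
    refine Ideal.exists_pow_le_of_le_radical_of_fg ?_ (IsNoetherian.noetherian _)
    rw [Ideal.radical_eq_sInf]
    refine le_sInf fun P hP => ?_
    have := hP.2
    exact hs.2 ⟨hP.2, hP.1⟩ (le_maximalIdeal hP.2.ne_top)
  rw [← hmap, ← hqs, ← Ideal.map_pow, Ideal.map_le_iff_le_comap,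
    Ideal.comap_map_of_surjective _ Ideal.Quotient.mk_surjective, ← RingHom.ker_eq_comap_bot,
    Ideal.mk_ker] at ha
  have htop : maximalIdeal R ^ a • (⊤ : Submodule R (R ⧸ p)) ≤ q • ⊤ := by
    refine (Submodule.smul_mono_left ha).trans ?_
    rw [Submodule.sup_smul]
    refine sup_le le_rfl (Submodule.smul_le.2 fun x hx b _ => ?_)
    obtain ⟨b, rfl⟩ := Ideal.Quotient.mk_surjective b
    have : x • Ideal.Quotient.mk p b = 0 := by
      rw [← Ideal.Quotient.mk_eq_mk, ← Submodule.Quotient.mk_smul]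
      exact (Submodule.Quotient.mk_eq_zero p).2 (p.mul_mem_right b hx)
    rw [this]
    exact zero_mem _
  have hmtop : relLength (maximalIdeal R • (⊤ : Submodule R (R ⧸ p))) ⊤ ≠ ⊤ := by
    have h1 : relLength (maximalIdeal R • (⊤ : Submodule R (R ⧸ p))) ⊤ ≤
        relLength (maximalIdeal R • (⊤ : Submodule R R)) ⊤ := by
      refine le_trans (le_of_eq ?_) (relLength_map_map_le p.mkQ _ _)
      rw [Submodule.map_smul'', Submodule.map_top, Submodule.range_mkQ]
    refine ne_top_of_le_ne_top ?_ h1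
    rw [relLength_top, Ideal.smul_eq_mul, Ideal.mul_top]
    have : IsSimpleModule R (R ⧸ maximalIdeal R) :=
      isSimpleModule_iff_quot_maximal.2 ⟨_, inferInstance, ⟨LinearEquiv.refl R _⟩⟩
    rw [Module.length_eq_one]
    exact ENat.one_ne_top
  obtain ⟨k, g, hg⟩ := Submodule.fg_iff_exists_fin_generating_family.1
    (IsNoetherian.noetherian (maximalIdeal R))
  have hqtop : relLength (q • (⊤ : Submodule R (R ⧸ p))) ⊤ ≠ ⊤ := by
    refine ne_top_of_le_ne_top ?_ (relLength_anti htop)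
    have h1 := relLength_smul_pow_top_le (M := R ⧸ p) g a
    rw [show Ideal.span (Set.range g) = maximalIdeal R from hg] at h1
    exact ne_top_of_le_ne_top (WithTop.mul_ne_top (ENat.natCast_ne_top _) hmtop) h1
  lift relLength (q • (⊤ : Submodule R (R ⧸ p))) ⊤ to ℕ using hqtop with l hl
  refine ⟨(e + 1) ^ e * l, fun t => ?_⟩
  refine (relLength_anti (Submodule.smul_mono_left (pow_le_pow_left' hqm t))).trans ?_
  refine (relLength_smul_pow_top_le y t).trans ?_
  rw [← hq, ← hl, Fintype.card_coe]
  norm_cast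
  calc (s.card + t) ^ s.card * l ≤ (e + 1 + t * (e + 1)) ^ e * l := by
        gcongr
        · omega
        · omega
        · exact Nat.le_mul_of_pos_right t (Nat.succ_pos e)
    _ = (e + 1) ^ e * l * (t + 1) ^ e := by
        rw [show e + 1 + t * (e + 1) = (e + 1) * (t + 1) by ring, mul_pow]
        ring

theorem exists_relLength_pow_le {d : ℕ} (hd : ringKrullDim R ≤ d) (M : Type*) [AddCommGroup M]
    [Module R M] [hM : Module.Finite R M] :
    ∃ C : ℕ, ∀ t, relLength (maximalIdeal R ^ t • (⊤ : Submodule R M)) ⊤ ≤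
      (C * (t + 1) ^ d : ℕ) := by
  induction hM using IsNoetherianRing.induction_on_isQuotientEquivQuotientPrime R with
  | subsingleton N =>
    exact ⟨0, fun t => by simp [relLength_eq_zero (le_of_eq (Subsingleton.elim _ _))]⟩
  | quotient N p f =>
    obtain ⟨C, hC⟩ := exists_relLength_pow_le_of_prime p.1
      ((ringKrullDim_quotient_le p.1).trans hd)
    refine ⟨C, fun t => le_trans (le_of_eq ?_) (hC t)⟩
    rw [← relLength_map_map_of_injective f.injective, Submodule.map_smul'', Submodule.map_top]
    simp
  | exact N₁ N₂ N₃ f g hf hg hfg h₁ h₃ =>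
    obtain ⟨C₁, hC₁⟩ := h₁
    obtain ⟨C₃, hC₃⟩ := h₃
    refine ⟨C₁ + C₃, fun t => (relLength_smul_top_le_of_exact hg hfg _).trans ?_⟩
    refine (add_le_add (hC₁ t) (hC₃ t)).trans (le_of_eq ?_)
    norm_cast
    ring

/-- The powers `𝔪^n (F / E)` stabilize, as `F / E` is Artinian, and by Nakayama's lemma they do so
at zero. -/
theorem exists_pow_smul_top_le {F : Type*} [AddCommGroup F] [Module R F] [Module.Finite R F]
    {E : Submodule R F} (hE : Module.length R (F ⧸ E) ≠ ⊤) :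
    ∃ k : ℕ, maximalIdeal R ^ k • (⊤ : Submodule R F) ≤ E := by
  have hfl := Module.length_ne_top_iff.1 hE
  have := (isFiniteLength_iff_isNoetherian_isArtinian.1 hfl).2
  obtain ⟨k, hk⟩ := IsArtinian.monotone_stabilizes (R := R) (M := F ⧸ E)
    ⟨fun n => OrderDual.toDual (maximalIdeal R ^ n • (⊤ : Submodule R (F ⧸ E))),
      fun a b hab => Submodule.smul_mono_left (Ideal.pow_le_pow_right hab)⟩
  have h1 : maximalIdeal R ^ k • (⊤ : Submodule R (F ⧸ E)) = maximalIdeal R ^ (k + 1) • ⊤ :=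
    hk (k + 1) (Nat.le_succ k)
  have h2 : maximalIdeal R ^ k • (⊤ : Submodule R (F ⧸ E)) = ⊥ := by
    refine Submodule.eq_bot_of_le_smul_of_le_jacobson_bot (maximalIdeal R) _
      (IsNoetherian.noetherian _) ?_ (maximalIdeal_le_jacobson _)
    rw [← mul_smul, ← pow_succ']
    exact h1.le
  refine ⟨k, ?_⟩
  rw [← E.ker_mkQ, ← Submodule.comap_bot, ← Submodule.map_le_iff_le_comap, Submodule.map_smul'',
    Submodule.map_top, Submodule.range_mkQ, h2]

end HilbertSamuel

/-! ### Polynomial growth of `λ(F^n V / E^n V)` -/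

section BigradedFamilies

variable {R : Type*} [CommRing R] {W : Type*} [AddCommGroup W] [Module R W]

/-- The sequences whose `i`-th term lies in `u i`. -/
def sequencesIn (u : ℕ → Submodule R W) : Submodule R (ℕ → W) :=
  Submodule.pi Set.univ u

theorem mem_sequencesIn {u : ℕ → Submodule R W} {f : ℕ → W} :
    f ∈ sequencesIn u ↔ ∀ i, f i ∈ u i := by
  simp [sequencesIn, Submodule.mem_pi]

theorem single_mem_sequencesIn {u : ℕ → Submodule R W} {i : ℕ} {w : W} :
    LinearMap.single R (fun _ : ℕ => W) i w ∈ sequencesIn u ↔ w ∈ u i := by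
  rw [mem_sequencesIn]
  constructor
  · intro h
    simpa using h i
  · intro h j
    rcases eq_or_ne j i with rfl | hj
    · simpa using h
    · simp [Pi.single_eq_of_ne hj]

theorem sequencesIn_mono {u v : ℕ → Submodule R W} (h : u ≤ v) : sequencesIn u ≤ sequencesIn v :=
  fun _ hf => mem_sequencesIn.2 fun i => h i (mem_sequencesIn.1 hf i)

theorem sequencesIn_update {u : ℕ → Submodule R W} {i : ℕ} {x : Submodule R W} (h : u i ≤ x) :
    sequencesIn (Function.update u i x) =
      sequencesIn u ⊔ x.map (LinearMap.single R (fun _ : ℕ => W) i) := by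
  refine le_antisymm ?_ (sup_le (sequencesIn_mono ?_) ?_)
  · intro f hf
    rw [mem_sequencesIn] at hf
    have hfi : f i ∈ x := by simpa using hf i
    rw [← sub_add_cancel f (LinearMap.single R (fun _ : ℕ => W) i (f i))]
    refine Submodule.add_mem_sup (mem_sequencesIn.2 fun j => ?_) ⟨f i, hfi, rfl⟩
    rcases eq_or_ne j i with rfl | hj
    · simp
    · have := hf j
      rw [Function.update_of_ne hj] at this
      simpa [Pi.single_eq_of_ne hj] using this
  · intro j
    rcases eq_or_ne j i with rfl | hj
    · simpa using h
    · rw [Function.update_of_ne hj]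
  · rw [Submodule.map_le_iff_le_comap]
    intro w hw
    exact single_mem_sequencesIn.2 (by simpa using hw)

theorem relLength_sequencesIn_update {u : ℕ → Submodule R W} {i : ℕ} {x : Submodule R W}
    (h : u i ≤ x) :
    relLength (sequencesIn u) (sequencesIn (Function.update u i x)) = relLength (u i) x := by
  rw [sequencesIn_update h, relLength_sup, relLength_map]
  congr 1
  ext w
  exact single_mem_sequencesIn

/-- The family that agrees with `v` below `m` and with `u` from `m` on. -/
def spliceAt (u v : ℕ → Submodule R W) (m : ℕ) : ℕ → Submodule R W :=
  fun i => if i < m then v i else u i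

theorem spliceAt_succ (u v : ℕ → Submodule R W) (m : ℕ) :
    spliceAt u v (m + 1) = Function.update (spliceAt u v m) m (v m) := by
  funext i
  rcases lt_trichotomy i m with h | rfl | h
  · simp [spliceAt, h, h.ne, show i < m + 1 by omega]
  · simp [spliceAt]
  · simp [spliceAt, h.ne', show ¬ i < m by omega, show ¬ i < m + 1 by omega]

theorem spliceAt_self (u v : ℕ → Submodule R W) (m : ℕ) : spliceAt u v m m = u m := by
  simp [spliceAt]

theorem relLength_sequencesIn_spliceAt {u v : ℕ → Submodule R W} (h : u ≤ v) (m : ℕ) :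
    relLength (sequencesIn u) (sequencesIn (spliceAt u v m)) =
      ∑ i ∈ Finset.range m, relLength (u i) (v i) := by
  induction m with
  | zero =>
    rw [Finset.sum_range_zero]
    exact relLength_eq_zero (sequencesIn_mono fun i => by simp [spliceAt])
  | succ m ih =>
    have h1 : spliceAt u v m m ≤ v m := (spliceAt_self u v m).le.trans (h m)
    rw [Finset.sum_range_succ, ← ih, spliceAt_succ,
      relLength_add (B := sequencesIn (spliceAt u v m)), relLength_sequencesIn_update h1,
      spliceAt_self]
    · refine sequencesIn_mono fun i => ?_
      by_cases hi : i < m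
      · simpa [spliceAt, hi] using h i
      · simp [spliceAt, hi]
    · rw [sequencesIn_update h1]
      exact le_sup_left

theorem sequencesIn_spliceAt_bot_fg {v : ℕ → Submodule R W} (h : ∀ i, (v i).FG) (m : ℕ) :
    (sequencesIn (spliceAt (fun _ => ⊥) v m)).FG := by
  induction m with
  | zero =>
    convert Submodule.fg_bot (R := R) (M := ℕ → W)
    rw [eq_bot_iff]
    intro f hf
    rw [mem_sequencesIn] at hf
    exact (Submodule.mem_bot R).2 (funext fun i => by simpa [spliceAt] using hf i)
  | succ m ih =>
    rw [spliceAt_succ, sequencesIn_update (by rw [spliceAt_self]; exact bot_le)]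
    exact ih.sup ((h m).map _)

theorem sequencesIn_spliceAt_bot_le {v : ℕ → Submodule R W} {m : ℕ} {P : Submodule R (ℕ → W)}
    (h : ∀ i < m, (v i).map (LinearMap.single R (fun _ : ℕ => W) i) ≤ P) :
    sequencesIn (spliceAt (fun _ => ⊥) v m) ≤ P := by
  induction m with
  | zero =>
    intro f hf
    rw [mem_sequencesIn] at hf
    have : f = 0 := funext fun i => by simpa [spliceAt] using hf i
    rw [this]
    exact P.zero_mem
  | succ m ih =>
    rw [spliceAt_succ, sequencesIn_update (by rw [spliceAt_self]; exact bot_le)]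
    exact sup_le (ih fun i hi => h i (hi.trans (Nat.lt_succ_self m))) (h m (Nat.lt_succ_self m))

end BigradedFamilies

section ReesPolynomial

variable {R : Type*} [CommRing R] {B : Type*} [CommRing B] [Algebra R B]
  {W : Type*} [AddCommGroup W] [Module R W] [Module B W] [IsScalarTower R B W]

theorem smul_smul_eq (P Q : Submodule R B) (V : Submodule R W) : P • Q • V = (P * Q) • V :=
  (Submodule.smul_assoc P Q V).symm

/-- Multiplication by `b` on sequences. -/
noncomputable def mulSeq (b : B) : Module.End R (ℕ → W) :=
  LinearMap.pi fun i => Algebra.lsmul R R W b ∘ₗ LinearMap.proj i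

/-- Multiplication by `b` on sequences, followed by a shift. -/
noncomputable def mulShiftSeq (b : B) : Module.End R (ℕ → W) :=
  LinearMap.pi fun i => Nat.casesOn i 0 fun i => Algebra.lsmul R R W b ∘ₗ LinearMap.proj i

theorem mulSeq_apply (b : B) (f : ℕ → W) (i : ℕ) :
    mulSeq (R := R) b f i = b • f i := rfl

theorem mulShiftSeq_zero (b : B) (f : ℕ → W) : mulShiftSeq (R := R) b f 0 = 0 := rfl

theorem mulShiftSeq_succ (b : B) (f : ℕ → W) (i : ℕ) :
    mulShiftSeq (R := R) b f (i + 1) = b • f i := rfl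

theorem mulSeq_single (b : B) (i : ℕ) (w : W) :
    mulSeq (R := R) b (LinearMap.single R (fun _ : ℕ => W) i w) =
      LinearMap.single R (fun _ : ℕ => W) i (b • w) := by
  funext j
  rw [mulSeq_apply]
  rcases eq_or_ne j i with rfl | hj
  · simp
  · simp [Pi.single_eq_of_ne hj]

theorem mulShiftSeq_single (b : B) (i : ℕ) (w : W) :
    mulShiftSeq (R := R) b (LinearMap.single R (fun _ : ℕ => W) i w) =
      LinearMap.single R (fun _ : ℕ => W) (i + 1) (b • w) := by
  funext j
  rcases j with _ | j
  · simp [mulShiftSeq_zero]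
  · rw [mulShiftSeq_succ]
    rcases eq_or_ne j i with rfl | hj
    · simp
    · simp [Pi.single_eq_of_ne hj, Pi.single_eq_of_ne (show j + 1 ≠ i + 1 by omega)]

theorem commute_mulSeq_mulSeq (b c : B) :
    Commute (mulSeq (R := R) (W := W) b) (mulSeq c) :=
  LinearMap.ext fun f => funext fun i => smul_comm b c (f i)

theorem commute_mulSeq_mulShiftSeq (b c : B) :
    Commute (mulSeq (R := R) (W := W) b) (mulShiftSeq c) :=
  LinearMap.ext fun f => funext fun i => by
    rcases i with _ | i
    · exact smul_zero b
    · exact smul_comm b c (f i)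

theorem commute_mulShiftSeq_mulShiftSeq (b c : B) :
    Commute (mulShiftSeq (R := R) (W := W) b) (mulShiftSeq c) :=
  LinearMap.ext fun f => funext fun i => by
    rcases i with _ | _ | i
    · rfl
    · exact (smul_zero b).trans (smul_zero c).symm
    · exact smul_comm b c (f i)

theorem span_smul_le {G : Set B} {P : Submodule R B} (hP : Submodule.span R G = P)
    {V Z : Submodule R W} (h : ∀ g ∈ G, ∀ v ∈ V, g • v ∈ Z) : P • V ≤ Z := by
  refine (smul_le_iSup_map_lsmul (g := ((↑) : G → B)) (by simp [hP]) V).trans ?_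
  refine iSup_le fun g => ?_
  rintro _ ⟨v, hv, rfl⟩
  exact h g g.2 v hv

theorem smul_fg {P : Submodule R B} (hP : P.FG) {V : Submodule R W} (hV : V.FG) : (P • V).FG := by
  obtain ⟨G, hG⟩ := hP
  have h : P • V = ⨆ g : G, V.map (Algebra.lsmul R R W g.1) := by
    refine le_antisymm (smul_le_iSup_map_lsmul (by simp [hG]) V) (iSup_le fun g => ?_)
    rintro _ ⟨v, hv, rfl⟩
    exact Submodule.smul_mem_smul (hG ▸ Submodule.subset_span g.2) hv
  rw [h]
  exact Submodule.fg_iSup _ fun g => hV.map _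

/-- The filtration of `Q^n V / P^n V` by the images of `P^i Q^(n-i) V`. -/
theorem relLength_pow_smul_eq_sum {P Q : Submodule R B} (hPQ : P ≤ Q) (V : Submodule R W) (n : ℕ) :
    relLength (P ^ n • V) (Q ^ n • V) =
      ∑ i ∈ Finset.range n, relLength ((P ^ (i + 1) * Q ^ (n - 1 - i)) • V)
        ((P ^ i * Q ^ (n - i)) • V) := by
  have key : ∀ m ≤ n, relLength ((P ^ m * Q ^ (n - m)) • V) (Q ^ n • V) =
      ∑ i ∈ Finset.range m, relLength ((P ^ (i + 1) * Q ^ (n - 1 - i)) • V)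
        ((P ^ i * Q ^ (n - i)) • V) := by
    intro m hm
    induction m with
    | zero => simp [relLength_eq_zero]
    | succ m ih =>
      obtain ⟨k, rfl⟩ : ∃ k, n = m + k + 1 := ⟨n - m - 1, by omega⟩
      rw [Finset.sum_range_succ, ← ih (by omega), add_comm (relLength _ _)]
      rw [show m + k + 1 - (m + 1) = k by omega, show m + k + 1 - m = k + 1 by omega,
        show m + k + 1 - 1 - m = k by omega]
      refine relLength_add (Submodule.smul_mono_left ?_) (Submodule.smul_mono_left ?_)
      · rw [pow_succ, pow_succ' Q, mul_assoc]
        gcongr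
      · rw [show m + k + 1 = m + (k + 1) by omega, pow_add Q m (k + 1)]
        gcongr
  simpa using key n le_rfl

/-- The length of `Q^n V / P^n V` is eventually polynomial: it is the Hilbert function, for the
total degree, of the module `⨁ P^i Q^j V / P^(i+1) Q^(j-1) V` with `j ≥ 1`, which is finitely
generated over a polynomial ring with variables for the generators of `P` and of `Q`. -/
theorem exists_polynomial_relLength_pow_smul [IsNoetherianRing R] {P Q : Submodule R B}
    (hPQ : P ≤ Q) (hP : P.FG) (hQ : Q.FG) {V : Submodule R W} (hV : V.FG)
    (hfin : ∀ n, relLength (P ^ n • V) (Q ^ n • V) ≠ ⊤) :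
    ∃ p : Polynomial ℚ, ∀ᶠ n : ℕ in atTop,
      ((relLength (P ^ n • V) (Q ^ n • V)).toNat : ℚ) = p.eval (n : ℚ) := by
  obtain ⟨S, hS⟩ := id hP
  obtain ⟨T, hT⟩ := id hQ
  -- The part of total degree `n` of the bigraded module is modelled by sequences: the `i`-th term
  -- of a sequence in `U' n` has bidegree `(i, n - i)` and lies in `u n i`. The generators of `Q`
  -- act by multiplication, those of `P` also raise the index `i`.
  let u : ℕ → ℕ → Submodule R W := fun n i => (P ^ i * Q ^ (n - i)) • V
  let v : ℕ → ℕ → Submodule R W := fun n i => (P ^ (i + 1) * Q ^ (n - 1 - i)) • V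
  have hvu : ∀ n i, i < n → v n i ≤ u n i := by
    intro n i hi
    obtain ⟨k, rfl⟩ : ∃ k, n = i + k + 1 := ⟨n - i - 1, by omega⟩
    refine Submodule.smul_mono_left ?_
    rw [show i + k + 1 - i = k + 1 by omega, show i + k + 1 - 1 - i = k by omega,
      pow_succ, pow_succ' Q, mul_assoc]
    gcongr
  have hufg : ∀ n i, (u n i).FG :=
    fun n i => smul_fg ((hP.pow i).mul (hQ.pow (n - i))) hV
  let U' : ℕ → ℕ → Submodule R W := fun n => spliceAt (fun _ => ⊥) (u n) n
  let V' : ℕ → ℕ → Submodule R W := fun n => spliceAt (fun _ => ⊥) (v n) n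
  have hVU' : ∀ n, V' n ≤ U' n := by
    intro n i
    by_cases hi : i < n
    · simpa [U', V', spliceAt, hi] using hvu n i hi
    · simp [U', V', spliceAt, hi]
  have hlen : ∀ n, relLength (sequencesIn (V' n)) (sequencesIn (U' n)) =
      relLength (P ^ n • V) (Q ^ n • V) := by
    intro n
    have h1 : U' n = spliceAt (V' n) (U' n) n := by
      funext i
      by_cases hi : i < n <;> simp [U', V', spliceAt, hi]
    rw [relLength_pow_smul_eq_sum hPQ, h1, relLength_sequencesIn_spliceAt (hVU' n)]
    refine Finset.sum_congr rfl fun i hi => ?_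
    simp [U', V', u, v, spliceAt, Finset.mem_range.1 hi]
  let s : Set (Module.End R (ℕ → W)) := mulSeq '' (T : Set B) ∪ mulShiftSeq '' (S : Set B)
  have hs : s.Finite := (T.finite_toSet.image _).union (S.finite_toSet.image _)
  have hcomm : ∀ x ∈ s, ∀ y ∈ s, Commute x y := by
    rintro _ (⟨b, _, rfl⟩ | ⟨b, _, rfl⟩) _ (⟨c, _, rfl⟩ | ⟨c, _, rfl⟩)
    · exact commute_mulSeq_mulSeq b c
    · exact commute_mulSeq_mulShiftSeq b c
    · exact (commute_mulSeq_mulShiftSeq c b).symm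
    · exact commute_mulShiftSeq_mulShiftSeq b c
  have hTQ : ∀ b ∈ T, b ∈ Q := fun b hb => hT ▸ Submodule.subset_span hb
  have hSP : ∀ b ∈ S, b ∈ P := fun b hb => hS ▸ Submodule.subset_span hb
  have hstable : ∀ w : ℕ → ℕ → Submodule R W,
      (∀ n, ∀ i < n, Q • w n i ≤ w (n + 1) i) → (∀ n, ∀ i < n, P • w n i ≤ w (n + 1) (i + 1)) →
      IsStable s fun n => sequencesIn (spliceAt (fun _ => ⊥) (w n) n) := by
    rintro w hQw hPw _ (⟨b, hb, rfl⟩ | ⟨b, hb, rfl⟩) n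
    · rw [Submodule.map_le_iff_le_comap]
      refine sequencesIn_spliceAt_bot_le fun i hi => ?_
      rintro _ ⟨y, hy, rfl⟩
      rw [Submodule.mem_comap, mulSeq_single, single_mem_sequencesIn]
      simp only [spliceAt, show i < n + 1 by omega, if_true]
      exact hQw n i hi (Submodule.smul_mem_smul (hTQ b hb) hy)
    · rw [Submodule.map_le_iff_le_comap]
      refine sequencesIn_spliceAt_bot_le fun i hi => ?_
      rintro _ ⟨y, hy, rfl⟩
      rw [Submodule.mem_comap, mulShiftSeq_single, single_mem_sequencesIn]
      simp only [spliceAt, show i + 1 < n + 1 by omega, if_true]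
      exact hPw n i hi (Submodule.smul_mem_smul (hSP b hb) hy)
  have hQu : ∀ n i, i ≤ n → Q • u n i = u (n + 1) i := by
    intro n i hi
    simp only [u]
    rw [smul_smul_eq, show n + 1 - i = n - i + 1 by omega, pow_succ, mul_comm, mul_assoc]
  have hPu : ∀ n i, P • u n i = u (n + 1) (i + 1) := by
    intro n i
    simp only [u]
    rw [smul_smul_eq, show n + 1 - (i + 1) = n - i by omega, pow_succ', mul_assoc]
  have hQv : ∀ n i, i < n → Q • v n i = v (n + 1) i := by
    intro n i hi
    simp only [v]
    rw [smul_smul_eq, show n + 1 - 1 - i = n - 1 - i + 1 by omega, pow_succ Q, mul_comm, mul_assoc]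
  have hPv : ∀ n i, i < n → P • v n i = v (n + 1) (i + 1) := by
    intro n i hi
    simp only [v]
    rw [smul_smul_eq, show n + 1 - 1 - (i + 1) = n - 1 - i by omega, pow_succ' P (i + 1), mul_assoc]
  have hU : IsStable s fun n => sequencesIn (U' n) :=
    hstable u (fun n i hi => (hQu n i hi.le).le) fun n i _ => (hPu n i).le
  have hN : IsNoetherianFamily s (fun n => sequencesIn (V' n)) fun n => sequencesIn (U' n) := by
    refine isNoetherianFamily_of_fg hs hcomm hU
      (fun n => sequencesIn_spliceAt_bot_fg (hufg n) n) ?_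
    filter_upwards [eventually_ge_atTop 1] with n hn
    refine sequencesIn_spliceAt_bot_le fun i hi => ?_
    rw [Submodule.map_le_iff_le_comap]
    rcases Nat.lt_succ_iff_lt_or_eq.1 hi with h | rfl
    · rw [← hQu n i h.le]
      refine span_smul_le hT fun b hb y hy => ?_
      refine Submodule.mem_iSup_of_mem (mulSeq b) (Submodule.mem_iSup_of_mem
        (Or.inl ⟨b, hb, rfl⟩) ⟨LinearMap.single R (fun _ : ℕ => W) i y, ?_, mulSeq_single b i y⟩)
      exact single_mem_sequencesIn.2 (by simpa [U', spliceAt, h] using hy)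
    · obtain ⟨m, rfl⟩ : ∃ m, i = m + 1 := ⟨i - 1, by omega⟩
      rw [← hPu]
      refine span_smul_le hS fun b hb y hy => ?_
      refine Submodule.mem_iSup_of_mem (mulShiftSeq b) (Submodule.mem_iSup_of_mem
        (Or.inr ⟨b, hb, rfl⟩)
        ⟨LinearMap.single R (fun _ : ℕ => W) m y, ?_, mulShiftSeq_single b m y⟩)
      exact single_mem_sequencesIn.2 (by simpa [U', spliceAt] using hy)
  obtain ⟨p, hp⟩ := exists_hilbertPolynomial hs hcomm _ _
    (fun n => sequencesIn_mono (hVU' n))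
    (hstable v (fun n i hi => (hQv n i hi).le) fun n i hi => (hPv n i hi).le) hU hN
    (fun n => hlen n ▸ hfin n)
  refine ⟨p, ?_⟩
  filter_upwards [hp] with n hn
  rw [← hn, hlen]

end ReesPolynomial

open scoped TensorProduct

/-! ### Submodules of `R[X₁, …, X_r] ⊗ M` -/

section PolynomialModel

variable {R : Type*} [CommRing R] {r : ℕ}

variable (R r) in
/-- The linear form `∑ vᵢ Xᵢ` attached to `v ∈ F = R^r`. -/
noncomputable def linearForm : (Fin r → R) →ₗ[R] MvPolynomial (Fin r) R :=
  Fintype.linearCombination R MvPolynomial.X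

variable (R r) in
/-- The polynomial model of `F = R^r`: the module of all linear forms. -/
noncomputable def allForms : Submodule R (MvPolynomial (Fin r) R) :=
  MvPolynomial.homogeneousSubmodule (Fin r) R 1

/-- The polynomial model of `E ⊆ R^r`: the linear forms with coefficient vector in `E`. -/
noncomputable def formsIn (E : Submodule R (Fin r → R)) : Submodule R (MvPolynomial (Fin r) R) :=
  E.map (linearForm R r)

theorem allForms_eq_range : allForms R r = LinearMap.range (linearForm R r) := by
  rw [linearForm, Fintype.range_linearCombination, allForms,
    MvPolynomial.homogeneousSubmodule_one_eq_span_X]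

theorem formsIn_le (E : Submodule R (Fin r → R)) : formsIn E ≤ allForms R r := by
  rw [allForms_eq_range]
  exact LinearMap.map_le_range

theorem allForms_pow (n : ℕ) :
    allForms R r ^ n = MvPolynomial.homogeneousSubmodule (Fin r) R n :=
  MvPolynomial.homogeneousSubmodule_one_pow ..

variable (R r) in
/-- The degree-zero part `1 ⊗ M` of the polynomial model `R[X₁, …, X_r] ⊗ M`. -/
noncomputable def constants (M : Type*) [AddCommGroup M] [Module R M] :
    Submodule R (MvPolynomial (Fin r) R ⊗[R] M) :=
  LinearMap.range (TensorProduct.mk R (MvPolynomial (Fin r) R) M 1)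

variable {M : Type*} [AddCommGroup M] [Module R M]

theorem one_tmul_mem_constants (m : M) :
    (1 : MvPolynomial (Fin r) R) ⊗ₜ[R] m ∈ constants R r M := ⟨m, rfl⟩

theorem tmul_mem_smul_constants {P : Submodule R (MvPolynomial (Fin r) R)}
    {b : MvPolynomial (Fin r) R} (hb : b ∈ P) (m : M) : b ⊗ₜ[R] m ∈ P • constants R r M := by
  have h := Submodule.smul_mem_smul hb (one_tmul_mem_constants (r := r) m)
  rwa [TensorProduct.smul_tmul', smul_eq_mul, mul_one] at h

theorem smul_constants_le {P : Submodule R (MvPolynomial (Fin r) R)}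
    {Z : Submodule R (MvPolynomial (Fin r) R ⊗[R] M)} (h : ∀ b ∈ P, ∀ m : M, b ⊗ₜ[R] m ∈ Z) :
    P • constants R r M ≤ Z := by
  rw [Submodule.smul_le]
  rintro b hb _ ⟨m, rfl⟩
  simpa [TensorProduct.smul_tmul'] using h b hb m

/-- The image of `P ⊗ M` in `R[X₁, …, X_r] ⊗ M` is generated by the image of `P`. -/
theorem range_rTensor_eq {P : Type*} [AddCommGroup P] [Module R P]
    (g : P →ₗ[R] MvPolynomial (Fin r) R) :
    LinearMap.range (g.rTensor M) = LinearMap.range g • constants R r M := by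
  refine le_antisymm ?_ (smul_constants_le ?_)
  · rintro _ ⟨t, rfl⟩
    induction t using TensorProduct.induction_on with
    | zero => simp
    | tmul x m =>
      rw [LinearMap.rTensor_tmul]
      exact tmul_mem_smul_constants (LinearMap.mem_range_self g x) m
    | add s t hs ht =>
      rw [map_add]
      exact add_mem hs ht
  · rintro _ ⟨x, rfl⟩ m
    exact ⟨x ⊗ₜ m, rfl⟩

/-- Tensoring with `M` preserves the injectivity of the inclusion of a homogeneous component, which
is a direct summand of the polynomial ring. -/
theorem rTensor_injective_of_range_eq {P : Type*} [AddCommGroup P] [Module R P]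
    {j : P →ₗ[R] MvPolynomial (Fin r) R} (hj : Function.Injective j) {n : ℕ}
    (hrange : LinearMap.range j = MvPolynomial.homogeneousSubmodule (Fin r) R n) :
    Function.Injective (j.rTensor M) := by
  let ρ : MvPolynomial (Fin r) R →ₗ[R] P :=
    (LinearEquiv.ofInjective j hj).symm.toLinearMap ∘ₗ
      (MvPolynomial.homogeneousComponent n).codRestrict _ fun b =>
        hrange ▸ MvPolynomial.homogeneousComponent_mem n b
  have hρ : ρ ∘ₗ j = LinearMap.id := by
    ext x
    have hx : j x ∈ MvPolynomial.homogeneousSubmodule (Fin r) R n := hrange ▸ ⟨x, rfl⟩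
    rw [LinearMap.id_apply, LinearMap.comp_apply, LinearMap.comp_apply, LinearEquiv.coe_coe,
      LinearEquiv.symm_apply_eq]
    apply Subtype.ext
    rw [LinearMap.codRestrict_apply, MvPolynomial.homogeneousComponent_of_mem hx, if_pos rfl]
    rfl
  refine Function.LeftInverse.injective (g := ρ.rTensor M) fun t => ?_
  rw [← LinearMap.comp_apply, ← LinearMap.rTensor_comp, hρ, LinearMap.rTensor_id,
    LinearMap.id_apply]

theorem length_quotient_tensor_eq_relLength {P : Type*} [AddCommGroup P] [Module R P]
    {j : P →ₗ[R] MvPolynomial (Fin r) R} (hj : Function.Injective j) {n : ℕ}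
    (hrange : LinearMap.range j = MvPolynomial.homogeneousSubmodule (Fin r) R n)
    (P' : Submodule R P) :
    Module.length R ((P ⧸ P') ⊗[R] M) =
      relLength (LinearMap.range (j ∘ₗ P'.subtype) • constants R r M)
        (LinearMap.range j • constants R r M) := by
  have hex : Function.Exact (P'.subtype.rTensor M) (P'.mkQ.rTensor M) :=
    rTensor_exact M (LinearMap.exact_subtype_mkQ P') P'.mkQ_surjective
  have hsurj : Function.Surjective (P'.mkQ.rTensor M) :=
    LinearMap.rTensor_surjective M P'.mkQ_surjective
  have h1 : Module.length R ((P ⧸ P') ⊗[R] M) =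
      relLength (LinearMap.range (P'.subtype.rTensor M)) ⊤ := by
    rw [relLength_top, ← LinearMap.exact_iff.1 hex]
    exact ((P'.mkQ.rTensor M).quotKerEquivOfSurjective hsurj).length_eq.symm
  rw [h1, ← relLength_map_map_of_injective (rTensor_injective_of_range_eq hj hrange),
    ← LinearMap.range_comp, ← LinearMap.rTensor_comp, ← LinearMap.range_eq_map, range_rTensor_eq,
    range_rTensor_eq]

/-- `(F^n / E^n) ⊗ M` is isomorphic to `F^n M / E^n M` inside `R[X₁, …, X_r] ⊗ M`: the map
`E^n ⊗ M → F^n ⊗ M` need not be injective, but its image is `E^n M`, and `F^n ⊗ M = F^n M`. -/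
theorem brLength_eq_relLength (E : Submodule R (Fin r → R)) (n : ℕ) :
    brLength E M n =
      relLength (formsIn E ^ n • constants R r M) (allForms R r ^ n • constants R r M) := by
  let e := SymmetricAlgebra.equivMvPolynomial (Pi.basisFun R (Fin r))
  have he : e.toLinearMap ∘ₗ SymmetricAlgebra.ι R (Fin r → R) = linearForm R r := by
    refine (Pi.basisFun R (Fin r)).ext fun i => ?_
    rw [LinearMap.comp_apply, AlgEquiv.toLinearMap_apply,
      SymmetricAlgebra.equivMvPolynomial_ι_apply]
    simp [linearForm, Fintype.linearCombination_apply, Pi.single_apply]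
  have hsym : (symComponent R (Fin r → R) n).map e.toLinearMap = allForms R r ^ n := by
    rw [symComponent, allForms_eq_range, ← he, LinearMap.range_comp]
    exact Submodule.map_pow _ e.toAlgHom n
  have hrees : (reesComponent E n).map e.toLinearMap = formsIn E ^ n := by
    rw [reesComponent_eq_pow, formsIn, ← he, Submodule.map_comp]
    exact Submodule.map_pow _ e.toAlgHom n
  let E' := (reesComponent E n).submoduleOf (symComponent R (Fin r → R) n)
  let j : symComponent R (Fin r → R) n →ₗ[R] MvPolynomial (Fin r) R :=
    e.toLinearMap ∘ₗ (symComponent R (Fin r → R) n).subtype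
  have hj : LinearMap.range j = allForms R r ^ n := by
    rw [LinearMap.range_comp, Submodule.range_subtype, hsym]
  have hjE : LinearMap.range (j ∘ₗ E'.subtype) = formsIn E ^ n := by
    have h : E'.map (symComponent R (Fin r → R) n).subtype = reesComponent E n :=
      (Submodule.map_comap_subtype _ _).trans (inf_eq_right.2 (reesComponent_le E n))
    rw [LinearMap.range_comp, Submodule.range_subtype, Submodule.map_comp, h, hrees]
  have key := length_quotient_tensor_eq_relLength (M := M) (j := j)
    (e.injective.comp Subtype.val_injective) (hj.trans (allForms_pow n)) E'
  rw [hjE, hj] at key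
  exact key

theorem allForms_fg : (allForms R r).FG :=
  MvPolynomial.homogeneousSubmodule_fg ..

theorem formsIn_fg [IsNoetherianRing R] (E : Submodule R (Fin r → R)) : (formsIn E).FG :=
  (IsNoetherian.noetherian E).map _

theorem constants_fg [Module.Finite R M] : (constants R r M).FG := by
  rw [constants, LinearMap.range_eq_map]
  exact Module.Finite.fg_top.map _

/-- The functoriality in `M` of `R[X₁, …, X_r] ⊗ M`. -/
theorem map_lTensor_smul {M' : Type*} [AddCommGroup M'] [Module R M'] (f : M' →ₗ[R] M)
    (P : Submodule R (MvPolynomial (Fin r) R)) :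
    (P • constants R r M').map (f.lTensor (MvPolynomial (Fin r) R)) ≤ P • constants R r M := by
  rw [Submodule.map_le_iff_le_comap]
  exact smul_constants_le fun b hb m => tmul_mem_smul_constants hb (f m)

theorem map_lTensor_smul_of_surjective {M' : Type*} [AddCommGroup M'] [Module R M']
    {f : M' →ₗ[R] M} (hf : Function.Surjective f) (P : Submodule R (MvPolynomial (Fin r) R)) :
    (P • constants R r M').map (f.lTensor (MvPolynomial (Fin r) R)) = P • constants R r M := by
  refine le_antisymm (map_lTensor_smul f P) (smul_constants_le fun b hb m => ?_)
  obtain ⟨m, rfl⟩ := hf m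
  exact ⟨b ⊗ₜ m, tmul_mem_smul_constants hb m, rfl⟩

end PolynomialModel

/-! ### Homogeneous components -/

section Components

variable {R : Type*} [CommRing R] {r : ℕ} {M : Type*} [AddCommGroup M] [Module R M]

theorem homogeneousComponent_mul_of_mem {a n : ℕ} {p : MvPolynomial (Fin r) R}
    (hp : p ∈ MvPolynomial.homogeneousSubmodule (Fin r) R a) (q : MvPolynomial (Fin r) R) :
    MvPolynomial.homogeneousComponent n (p * q) =
      if a ≤ n then p * MvPolynomial.homogeneousComponent (n - a) q else 0 := by
  have hmul : ∀ i, p * MvPolynomial.homogeneousComponent i q ∈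
      MvPolynomial.homogeneousSubmodule (Fin r) R (a + i) := fun i =>
    MvPolynomial.IsHomogeneous.mul hp (MvPolynomial.homogeneousComponent_isHomogeneous i q)
  conv_lhs => rw [← MvPolynomial.sum_homogeneousComponent q, Finset.mul_sum, map_sum]
  simp_rw [MvPolynomial.homogeneousComponent_of_mem (hmul _)]
  split_ifs with h
  · rw [Finset.sum_eq_single (n - a)]
    · rw [if_pos (by omega)]
    · intro i _ hi
      rw [if_neg (by omega)]
    · intro hi
      rw [MvPolynomial.homogeneousComponent_eq_zero _ _ (by simp at hi; omega)]
      simp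
  · exact Finset.sum_eq_zero fun i _ => if_neg (by omega)

variable (M) in
/-- The projection of `R[X₁, …, X_r] ⊗ M` to its component of degree `n`. -/
noncomputable def component (n : ℕ) : Module.End R (MvPolynomial (Fin r) R ⊗[R] M) :=
  (MvPolynomial.homogeneousComponent n).rTensor M

theorem component_tmul (n : ℕ) (b : MvPolynomial (Fin r) R) (m : M) :
    component M n (b ⊗ₜ[R] m) = MvPolynomial.homogeneousComponent n b ⊗ₜ m := rfl

theorem component_smul {a n : ℕ} {p : MvPolynomial (Fin r) R}
    (hp : p ∈ MvPolynomial.homogeneousSubmodule (Fin r) R a) (w : MvPolynomial (Fin r) R ⊗[R] M) :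
    component M n (p • w) = if a ≤ n then p • component M (n - a) w else 0 := by
  induction w using TensorProduct.induction_on with
  | zero => simp
  | tmul b m =>
    rw [TensorProduct.smul_tmul', smul_eq_mul, component_tmul, component_tmul,
      homogeneousComponent_mul_of_mem hp]
    split_ifs
    · rw [TensorProduct.smul_tmul', smul_eq_mul]
    · rw [TensorProduct.zero_tmul]
  | add v w hv hw =>
    rw [smul_add, map_add, hv, hw, map_add]
    split_ifs
    · rw [smul_add]
    · rw [add_zero]

theorem component_mem (n : ℕ) (w : MvPolynomial (Fin r) R ⊗[R] M) :
    component M n w ∈ allForms R r ^ n • constants R r M := by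
  induction w using TensorProduct.induction_on with
  | zero => simp
  | tmul b m =>
    rw [component_tmul, allForms_pow]
    exact tmul_mem_smul_constants (MvPolynomial.homogeneousComponent_mem n b) m
  | add v w hv hw =>
    rw [map_add]
    exact add_mem hv hw

theorem component_eq_self {n : ℕ} {w : MvPolynomial (Fin r) R ⊗[R] M}
    (hw : w ∈ allForms R r ^ n • constants R r M) : component M n w = w := by
  rw [allForms_pow] at hw
  have h : MvPolynomial.homogeneousSubmodule (Fin r) R n • constants R r M ≤
      LinearMap.eqLocus (component M n) LinearMap.id := smul_constants_le fun b hb m => by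
    rw [LinearMap.mem_eqLocus, component_tmul, MvPolynomial.homogeneousComponent_of_mem hb,
      if_pos rfl, LinearMap.id_apply]
  exact h hw

theorem component_lTensor {M' : Type*} [AddCommGroup M'] [Module R M'] (f : M' →ₗ[R] M) (n : ℕ)
    (w : MvPolynomial (Fin r) R ⊗[R] M') :
    component M n (f.lTensor _ w) = f.lTensor _ (component M' n w) := by
  induction w using TensorProduct.induction_on with
  | zero => simp
  | tmul b m => rfl
  | add v w hv hw => simp only [map_add, hv, hw]

end Components

/-! ### Artin–Rees lemmas -/

section ArtinRees

variable {R : Type*} [CommRing R] {r : ℕ} {M : Type*} [AddCommGroup M] [Module R M]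

theorem formsIn_pow_le (E : Submodule R (Fin r → R)) (n : ℕ) :
    formsIn E ^ n ≤ MvPolynomial.homogeneousSubmodule (Fin r) R n :=
  (pow_le_pow_left' (formsIn_le E) n).trans (allForms_pow n).le

/-- The degree-`n` part of `I^a (R[X] ⊗ M)`, for the ideal `I` generated by `E`, is
`E^a F^(n-a) M`. -/
theorem component_mem_of_mem_pow_smul (E : Submodule R (Fin r → R)) {a n : ℕ} (han : a ≤ n)
    {w : MvPolynomial (Fin r) R ⊗[R] M}
    (hw : w ∈ Ideal.span (formsIn E : Set (MvPolynomial (Fin r) R)) ^ a •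
      (⊤ : Submodule (MvPolynomial (Fin r) R) (MvPolynomial (Fin r) R ⊗[R] M))) :
    component M n w ∈ (formsIn E ^ a * allForms R r ^ (n - a)) • constants R r M := by
  have key : ∀ b ∈ Ideal.span (formsIn E : Set (MvPolynomial (Fin r) R)) ^ a,
      ∀ v : MvPolynomial (Fin r) R ⊗[R] M,
        component M n (b • v) ∈ (formsIn E ^ a * allForms R r ^ (n - a)) • constants R r M := by
    intro b hb
    rw [Ideal.span, Submodule.span_pow] at hb
    induction hb using Submodule.span_induction with
    | mem b hb =>
      intro v
      have hb : b ∈ formsIn E ^ a := Submodule.pow_subset_pow _ hb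
      rw [component_smul (formsIn_pow_le E a hb), if_pos han, ← smul_smul_eq]
      exact Submodule.smul_mem_smul hb (component_mem _ v)
    | zero => simp
    | add b c _ _ hb hc =>
      intro v
      rw [add_smul, map_add]
      exact add_mem (hb v) (hc v)
    | smul c b _ hb =>
      intro v
      rw [smul_assoc, smul_comm c b v]
      exact hb (c • v)
  refine Submodule.smul_induction_on (p := fun w => component M n w ∈
    (formsIn E ^ a * allForms R r ^ (n - a)) • constants R r M) hw (fun b hb v _ => key b hb v) ?_
  intro v w hv hw
  rw [map_add]
  exact add_mem hv hw

theorem pow_le_span_pow {B : Type*} [CommRing B] [Algebra R B] (P : Submodule R B) (i : ℕ) :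
    P ^ i ≤ (Ideal.span (P : Set B) ^ i).restrictScalars R := by
  induction i with
  | zero => simp [Ideal.one_eq_top]
  | succ i ih =>
    rw [pow_succ, Submodule.mul_le]
    intro b hb c hc
    rw [Submodule.restrictScalars_mem, pow_succ]
    exact Ideal.mul_mem_mul (ih hb) (Ideal.subset_span hc)

theorem pow_mul_smul_le_span_pow_smul {B : Type*} [CommRing B] [Algebra R B] {W : Type*}
    [AddCommGroup W] [Module R W] [Module B W] [IsScalarTower R B W] (P Q : Submodule R B)
    (V : Submodule R W) (i : ℕ) :
    (P ^ i * Q) • V ≤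
      (Ideal.span (P : Set B) ^ i • (⊤ : Submodule B W)).restrictScalars R := by
  rw [← smul_smul_eq, Submodule.smul_le]
  intro b hb v _
  have hb' : b ∈ Ideal.span (P : Set B) ^ i := pow_le_span_pow P i hb
  have h : b • v ∈ Ideal.span (P : Set B) ^ i • (⊤ : Submodule B W) :=
    Submodule.smul_mem_smul hb' Submodule.mem_top
  exact h

/-- A form of the Artin–Rees lemma for the range of a linear map. -/
theorem exists_mem_pow_smul_of_mem_range {B : Type*} [CommRing B] [IsNoetherianRing B]
    {W W' : Type*} [AddCommGroup W] [Module B W] [Module.Finite B W] [AddCommGroup W'] [Module B W']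
    (g : W' →ₗ[B] W) (I : Ideal B) :
    ∃ a, ∀ i, a ≤ i → ∀ w ∈ I ^ i • (⊤ : Submodule B W), w ∈ LinearMap.range g →
      ∃ u ∈ I ^ (i - a) • (⊤ : Submodule B W'), g u = w := by
  obtain ⟨a, ha⟩ := Ideal.exists_pow_inf_eq_pow_smul I (LinearMap.range g)
  refine ⟨a, fun i hai w hw hwg => ?_⟩
  have h1 : w ∈ I ^ i • ⊤ ⊓ LinearMap.range g := ⟨hw, hwg⟩
  rw [ha i hai] at h1
  have h2 : w ∈ I ^ (i - a) • LinearMap.range g := Submodule.smul_mono le_rfl inf_le_right h1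
  rw [LinearMap.range_eq_map, ← Submodule.map_smul''] at h2
  exact h2

theorem pow_mul_smul_constants_le (E : Submodule R (Fin r → R)) (a b : ℕ) :
    (formsIn E ^ a * allForms R r ^ b) • constants R r M ≤
      allForms R r ^ (a + b) • constants R r M := by
  refine Submodule.smul_mono_left ?_
  rw [pow_add]
  exact mul_le_mul_left (pow_le_pow_left' (formsIn_le E) a) _

/-- The Artin–Rees lemma for the ideal generated by the linear forms in `E` and the image of
`R[X] ⊗ M'` in `R[X] ⊗ M`, read off in each degree. -/
theorem exists_pow_mul_inf_range_le [IsNoetherianRing R] [Module.Finite R M] {M' : Type*}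
    [AddCommGroup M'] [Module R M'] (f : M' →ₗ[R] M) (E : Submodule R (Fin r → R)) :
    ∃ a, ∀ i j, a ≤ i → (formsIn E ^ i * allForms R r ^ j) • constants R r M ⊓
        LinearMap.range (f.lTensor (MvPolynomial (Fin r) R)) ≤
      ((formsIn E ^ (i - a) * allForms R r ^ (j + a)) • constants R r M').map
        (f.lTensor (MvPolynomial (Fin r) R)) := by
  obtain ⟨a, ha⟩ := exists_mem_pow_smul_of_mem_range (f.baseChange (MvPolynomial (Fin r) R))
    (Ideal.span (formsIn E : Set (MvPolynomial (Fin r) R)))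
  refine ⟨a, fun i j hai w hw => ?_⟩
  obtain ⟨hw, v, hv⟩ := hw
  have hwI : w ∈ Ideal.span (formsIn E : Set (MvPolynomial (Fin r) R)) ^ i •
      (⊤ : Submodule (MvPolynomial (Fin r) R) (MvPolynomial (Fin r) R ⊗[R] M)) :=
    pow_mul_smul_le_span_pow_smul (formsIn E) (allForms R r ^ j) (constants R r M) i hw
  have hwg : f.baseChange (MvPolynomial (Fin r) R) v = w := hv
  obtain ⟨u, hu, hgu⟩ := ha i hai w hwI ⟨v, hwg⟩
  refine ⟨component M' (i + j) u, ?_, ?_⟩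
  · have h3 := component_mem_of_mem_pow_smul E (n := i + j) (by omega) hu
    rwa [show i + j - (i - a) = j + a by omega] at h3
  · rw [← component_lTensor]
    have hgu' : f.lTensor (MvPolynomial (Fin r) R) u = w := hgu
    rw [hgu', component_eq_self (pow_mul_smul_constants_le E i j hw)]

end ArtinRees

/-! ### A uniform Artin–Rees lemma for multiples of a nonzerodivisor -/

section NonZeroDivisor

variable {R : Type*} [CommRing R] {r : ℕ} {M : Type*} [AddCommGroup M] [Module R M]

theorem component_smul_mem_of_mem_adjoin (E : Submodule R (Fin r → R))
    {S : Set (MvPolynomial (Fin r) R)} (hS : S ⊆ formsIn E) {b : MvPolynomial (Fin r) R}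
    (hb : b ∈ Algebra.adjoin R S) {w : MvPolynomial (Fin r) R ⊗[R] M}
    (hw : ∀ n, component M n w ∈ formsIn E ^ n • constants R r M) (n : ℕ) :
    component M n (b • w) ∈ formsIn E ^ n • constants R r M := by
  induction hb using Algebra.adjoin_induction generalizing w n with
  | mem b hb =>
    have hb1 : b ∈ MvPolynomial.homogeneousSubmodule (Fin r) R 1 := formsIn_le E (hS hb)
    rw [component_smul hb1]
    split_ifs with h
    · obtain ⟨k, rfl⟩ : ∃ k, n = k + 1 := ⟨n - 1, by omega⟩
      rw [pow_succ', ← smul_smul_eq]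
      exact Submodule.smul_mem_smul (hS hb) (hw k)
    · exact zero_mem _
  | algebraMap c =>
    rw [algebraMap_smul, map_smul]
    exact Submodule.smul_mem _ c (hw n)
  | add b c _ _ hb hc =>
    rw [add_smul, map_add]
    exact add_mem (hb hw n) (hc hw n)
  | mul b c _ _ hb hc =>
    rw [mul_smul]
    exact hb (hc hw) n

/-- The degree-`n` part of `R[E] M` is `E^n M`. -/
theorem component_mem_of_mem_span_adjoin (E : Submodule R (Fin r → R))
    {S : Set (MvPolynomial (Fin r) R)} (hS : S ⊆ formsIn E)
    {w : MvPolynomial (Fin r) R ⊗[R] M}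
    (hw : w ∈ Submodule.span (Algebra.adjoin R S)
      (constants R r M : Set (MvPolynomial (Fin r) R ⊗[R] M))) (n : ℕ) :
    component M n w ∈ formsIn E ^ n • constants R r M := by
  induction hw using Submodule.span_induction generalizing n with
  | mem w hw =>
    obtain ⟨m, rfl⟩ := hw
    rw [TensorProduct.mk_apply, component_tmul]
    have h1 : (1 : MvPolynomial (Fin r) R) ∈ MvPolynomial.homogeneousSubmodule (Fin r) R 0 :=
      MvPolynomial.isHomogeneous_one _ _
    rw [MvPolynomial.homogeneousComponent_of_mem h1]
    split_ifs with h
    · subst h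
      rw [pow_zero]
      exact tmul_mem_smul_constants (Submodule.one_le.1 le_rfl) m
    · simp
  | zero => simp
  | add v w _ _ hv hw =>
    rw [map_add]
    exact add_mem (hv n) (hw n)
  | smul a w _ hw => exact component_smul_mem_of_mem_adjoin E hS a.2 hw n

/-- The degree-`n` part of `I^b R[E] M` is `I^b E^n M`. -/
theorem component_mem_of_mem_map_pow_smul (E : Submodule R (Fin r → R))
    {S : Set (MvPolynomial (Fin r) R)} (hS : S ⊆ formsIn E) (I : Ideal R) (b : ℕ)
    {w : MvPolynomial (Fin r) R ⊗[R] M}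
    (hw : w ∈ I.map (algebraMap R (Algebra.adjoin R S)) ^ b • Submodule.span (Algebra.adjoin R S)
      (constants R r M : Set (MvPolynomial (Fin r) R ⊗[R] M))) (n : ℕ) :
    component M n w ∈ I ^ b • formsIn E ^ n • constants R r M := by
  rw [← Ideal.map_pow] at hw
  have key : ∀ a ∈ (I ^ b).map (algebraMap R (Algebra.adjoin R S)),
      ∀ v ∈ Submodule.span (Algebra.adjoin R S)
        (constants R r M : Set (MvPolynomial (Fin r) R ⊗[R] M)),
        component M n (a • v) ∈ I ^ b • formsIn E ^ n • constants R r M := by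
    intro a ha
    induction ha using Submodule.span_induction with
    | mem a ha =>
      intro v hv
      obtain ⟨x, hx, rfl⟩ := ha
      rw [algebraMap_smul, map_smul]
      exact Submodule.smul_mem_smul hx (component_mem_of_mem_span_adjoin E hS hv n)
    | zero =>
      intro v _
      rw [zero_smul, map_zero]
      exact zero_mem _
    | add a c _ _ ha hc =>
      intro v hv
      rw [add_smul, map_add]
      exact add_mem (ha v hv) (hc v hv)
    | smul c a _ ha =>
      intro v hv
      rw [smul_assoc, smul_comm c a v]
      exact ha (c • v) (Submodule.smul_mem _ c hv)
  refine Submodule.smul_induction_on (p := fun w => component M n w ∈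
    I ^ b • formsIn E ^ n • constants R r M) hw key ?_
  intro v w hv hw
  rw [map_add]
  exact add_mem hv hw

/-- The Artin–Rees lemma for the submodule of multiples of an element `y` that is a nonzerodivisor
on the ambient module. -/
theorem exists_mem_map_pow_smul_of_smul_mem {A : Type*} [CommRing A] [IsNoetherianRing A]
    [Algebra R A] {W : Type*} [AddCommGroup W] [Module R W] [Module A W] [IsScalarTower R A W]
    {U : Submodule A W} (hU : U.FG) (I : Ideal R) {y : R}
    (hy : Function.Injective fun w : W => y • w) :
    ∃ c, ∀ t, c ≤ t → ∀ u ∈ U, y • u ∈ I.map (algebraMap R A) ^ t • U →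
      u ∈ I.map (algebraMap R A) ^ (t - c) • U := by
  have : Module.Finite A U := Module.Finite.iff_fg.2 hU
  obtain ⟨c, hc⟩ := exists_mem_pow_smul_of_mem_range (LinearMap.lsmul A U (algebraMap R A y))
    (I.map (algebraMap R A))
  have hmap : ∀ k, (I.map (algebraMap R A) ^ k • (⊤ : Submodule A U)).map U.subtype =
      I.map (algebraMap R A) ^ k • U := by
    intro k
    rw [Submodule.map_smul'', Submodule.map_top, Submodule.range_subtype]
  refine ⟨c, fun t hct u hu hyu => ?_⟩
  rw [← hmap] at hyu
  obtain ⟨w, hw, hwy⟩ := hyu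
  rw [Submodule.subtype_apply] at hwy
  obtain ⟨v, hv, hvw⟩ := hc t hct w hw ⟨⟨u, hu⟩, Subtype.ext (by
    rw [hwy, LinearMap.lsmul_apply, algebraMap_smul]
    rfl)⟩
  have huv : v.1 = u := by
    refine hy ?_
    change y • v.1 = y • u
    rw [← hwy, ← hvw, LinearMap.lsmul_apply, algebraMap_smul]
    rfl
  rw [← hmap, ← huv]
  exact ⟨v, hv, rfl⟩

theorem isNoetherianRing_adjoin_of_finite {B : Type*} [CommRing B] [Algebra R B]
    [IsNoetherianRing R] {S : Set B} (hS : S.Finite) : IsNoetherianRing (Algebra.adjoin R S) := by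
  have := Algebra.FiniteType.adjoin_of_finite (R := R) hS
  exact Algebra.FiniteType.isNoetherianRing R _

theorem pow_smul_constants_le_span_adjoin {S : Set (MvPolynomial (Fin r) R)}
    {P : Submodule R (MvPolynomial (Fin r) R)} (hS : Submodule.span R S = P) (n : ℕ) :
    P ^ n • constants R r M ≤ (Submodule.span (Algebra.adjoin R S)
      (constants R r M : Set (MvPolynomial (Fin r) R ⊗[R] M))).restrictScalars R := by
  have hP : P ^ n ≤ Subalgebra.toSubmodule (Algebra.adjoin R S) := by
    have h1 : P ≤ Subalgebra.toSubmodule (Algebra.adjoin R S) := by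
      rw [← hS]
      exact Submodule.span_le.2 Algebra.subset_adjoin
    induction n with
    | zero =>
      rw [pow_zero, Submodule.one_le]
      exact (Algebra.adjoin R S).one_mem
    | succ n ih =>
      rw [pow_succ, Submodule.mul_le]
      exact fun b hb c hc => (Algebra.adjoin R S).mul_mem (ih hb) (h1 hc)
  rw [Submodule.smul_le]
  intro b hb v hv
  exact Submodule.smul_mem _ (⟨b, hP hb⟩ : Algebra.adjoin R S) (Submodule.subset_span hv)

/-- The Artin–Rees lemma in the Rees module `⨁ E^i M`, for the ideal generated by `I ⊆ R` and the
submodule of multiples of an element `y` that is a nonzerodivisor on `M`. The constant `c` does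
not depend on the degree `i`. -/
theorem exists_mem_pow_smul_of_smul_mem [IsNoetherianRing R] [Module.Finite R M]
    (E : Submodule R (Fin r → R)) (I : Ideal R) {y : R}
    (hy : Function.Injective fun m : M => y • m) :
    ∃ c, ∀ t i, c ≤ t → ∀ u ∈ formsIn E ^ i • constants R r M,
      y • u ∈ I ^ t • formsIn E ^ i • constants R r M →
      u ∈ I ^ (t - c) • formsIn E ^ i • constants R r M := by
  obtain ⟨S, hS⟩ := formsIn_fg E
  have hSE : (S : Set (MvPolynomial (Fin r) R)) ⊆ formsIn E := hS ▸ Submodule.subset_span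
  have := isNoetherianRing_adjoin_of_finite (R := R) S.finite_toSet
  have hUfg : (Submodule.span (Algebra.adjoin R (S : Set (MvPolynomial (Fin r) R)))
      (constants R r M : Set (MvPolynomial (Fin r) R ⊗[R] M))).FG := by
    obtain ⟨T, hT⟩ := constants_fg (R := R) (r := r) (M := M)
    refine ⟨T, le_antisymm (Submodule.span_mono (hT ▸ Submodule.subset_span)) ?_⟩
    rw [Submodule.span_le, ← hT]
    exact Submodule.span_le_restrictScalars R _ (T : Set (MvPolynomial (Fin r) R ⊗[R] M))
  have hyW : Function.Injective fun w : MvPolynomial (Fin r) R ⊗[R] M => y • w := by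
    have h1 := Module.Flat.lTensor_preserves_injective_linearMap (M := MvPolynomial (Fin r) R)
      (LinearMap.lsmul R M y) hy
    have h2 : (LinearMap.lsmul R M y).lTensor (MvPolynomial (Fin r) R) =
        LinearMap.lsmul R (MvPolynomial (Fin r) R ⊗[R] M) y :=
      TensorProduct.ext' fun b m => TensorProduct.tmul_smul y b m
    rw [h2] at h1
    exact h1
  obtain ⟨c, hc⟩ := exists_mem_map_pow_smul_of_smul_mem hUfg I hyW
  have hU := pow_smul_constants_le_span_adjoin (M := M) hS
  refine ⟨c, fun t i hct u hu hyu => ?_⟩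
  have h1 : I ^ t • formsIn E ^ i • constants R r M ≤
      (I.map (algebraMap R (Algebra.adjoin R (S : Set (MvPolynomial (Fin r) R)))) ^ t •
        Submodule.span (Algebra.adjoin R (S : Set (MvPolynomial (Fin r) R)))
          (constants R r M : Set (MvPolynomial (Fin r) R ⊗[R] M))).restrictScalars R := by
    rw [Submodule.smul_le]
    intro x hx v hv
    rw [Submodule.restrictScalars_mem, ← Ideal.map_pow,
      ← algebraMap_smul (Algebra.adjoin R (S : Set (MvPolynomial (Fin r) R))) x v]
    exact Submodule.smul_mem_smul (Ideal.mem_map_of_mem _ hx) (hU i hv)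
  have h2 := component_mem_of_mem_map_pow_smul E hSE I (t - c) (hc t hct u (hU i hu) (h1 hyu)) i
  rwa [component_eq_self] at h2
  exact Submodule.smul_mono_left (pow_le_pow_left' (formsIn_le E) i) hu

end NonZeroDivisor

/-! ### Ideals of the base ring, and sequences of lower order -/

section BaseIdeal

variable {R : Type*} [CommRing R] {B : Type*} [CommRing B] [Algebra R B]
  {W : Type*} [AddCommGroup W] [Module R W] [Module B W] [IsScalarTower R B W]

variable (B) in
/-- The image in an algebra `B` of an ideal of the base ring, as an `R`-submodule of `B`. -/
noncomputable def idealIn (I : Ideal R) : Submodule R B := Submodule.map (Algebra.linearMap R B) I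

theorem idealIn_smul (I : Ideal R) (V : Submodule R W) : idealIn B I • V = I • V := by
  refine le_antisymm (Submodule.smul_le.2 ?_) (Submodule.smul_le.2 ?_)
  · rintro _ ⟨x, hx, rfl⟩ v hv
    rw [Algebra.linearMap_apply, algebraMap_smul]
    exact Submodule.smul_mem_smul hx hv
  · intro x hx v hv
    rw [← algebraMap_smul B x v]
    have h : algebraMap R B x ∈ idealIn B I := ⟨x, hx, rfl⟩
    exact Submodule.smul_mem_smul h hv

theorem idealIn_pow (I : Ideal R) (n : ℕ) : idealIn B (I ^ n) = idealIn B I ^ n :=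
  Submodule.map_pow I (Algebra.ofId R B) n

end BaseIdeal

section LowerOrder

theorem add_pow_le_mul_pow (s n e : ℕ) : (s + n) ^ e ≤ (s + 1) ^ e * (n + 1) ^ e := by
  rw [← mul_pow]
  exact Nat.pow_le_pow_left (by nlinarith) e

theorem mul_multichoose_le (s n : ℕ) : n * Nat.multichoose s n ≤ (s + 1) ^ s * (n + 1) ^ s := by
  rcases s with _ | s
  · rcases n with _ | n <;> simp
  · calc n * Nat.multichoose (s + 1) n ≤ (s + 1 + n) * (s + 1 + n) ^ s := by
          gcongr
          · omega
          · exact multichoose_le_pow (s + 1) n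
      _ = (s + 1 + n) ^ (s + 1) := (pow_succ' _ _).symm
      _ ≤ _ := add_pow_le_mul_pow _ _ _

/-- A sequence of lengths of order `O(n^(e-1))`, in a form that makes sense for `e = 0`. -/
def IsLowerOrder (e : ℕ) (z : ℕ → ℕ∞) : Prop :=
  ∃ C : ℕ, ∀ᶠ n : ℕ in atTop, (n : ℕ∞) * z n ≤ (C * (n + 1) ^ e : ℕ)

theorem IsLowerOrder.add {e : ℕ} {z w : ℕ → ℕ∞} (hz : IsLowerOrder e z) (hw : IsLowerOrder e w) :
    IsLowerOrder e fun n => z n + w n := by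
  obtain ⟨C, hC⟩ := hz
  obtain ⟨D, hD⟩ := hw
  refine ⟨C + D, ?_⟩
  filter_upwards [hC, hD] with n h₁ h₂
  rw [mul_add, add_mul, Nat.cast_add]
  exact add_le_add h₁ h₂

theorem IsLowerOrder.mono {e : ℕ} {z w : ℕ → ℕ∞} (hz : IsLowerOrder e z)
    (h : ∀ᶠ n in atTop, w n ≤ z n) : IsLowerOrder e w := by
  obtain ⟨C, hC⟩ := hz
  refine ⟨C, ?_⟩
  filter_upwards [hC, h] with n h₁ h₂
  exact (mul_le_mul_right h₂ _).trans h₁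

theorem IsLowerOrder.const_mul {e : ℕ} {z : ℕ → ℕ∞} (hz : IsLowerOrder e z) (a : ℕ) :
    IsLowerOrder e fun n => a * z n := by
  obtain ⟨C, hC⟩ := hz
  refine ⟨a * C, ?_⟩
  filter_upwards [hC] with n hn
  calc (n : ℕ∞) * (a * z n) = a * (n * z n) := mul_left_comm _ _ _
    _ ≤ a * (C * (n + 1) ^ e : ℕ) := mul_le_mul_right hn _
    _ = _ := by push_cast; rw [mul_assoc]

theorem IsLowerOrder.shift {e : ℕ} {z : ℕ → ℕ∞} (hz : IsLowerOrder e z) (a : ℕ) :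
    IsLowerOrder e fun n => z (n - a) := by
  obtain ⟨C, hC⟩ := hz
  refine ⟨2 * C, ?_⟩
  have h := (tendsto_sub_atTop_nat a).eventually hC
  filter_upwards [h, eventually_ge_atTop (2 * a)] with n hn hna
  calc (n : ℕ∞) * z (n - a) ≤ (2 * (n - a : ℕ) : ℕ) * z (n - a) := by
        gcongr
        omega
    _ = 2 * ((n - a : ℕ) * z (n - a)) := by push_cast; rw [mul_assoc]
    _ ≤ 2 * (C * ((n - a) + 1) ^ e : ℕ) := mul_le_mul_right hn _
    _ = (2 * (C * ((n - a) + 1) ^ e) : ℕ) := by push_cast; rfl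
    _ ≤ (2 * C * (n + 1) ^ e : ℕ) := by
        rw [mul_assoc]
        gcongr
        omega

end LowerOrder

/-! ### Lengths of Rees quotients in short exact sequences -/

section Growth

variable {R : Type*} [CommRing R] {r : ℕ}

/-- The length of `F^n M / E^n M`. -/
noncomputable def reesLength (E : Submodule R (Fin r → R)) (M : Type*) [AddCommGroup M] [Module R M]
    (n : ℕ) : ℕ∞ :=
  relLength (formsIn E ^ n • constants R r M) (allForms R r ^ n • constants R r M)

/-- The length of `E^i F^c M / E^(i+c) M`. -/
noncomputable def gapLength (E : Submodule R (Fin r → R)) (M : Type*) [AddCommGroup M] [Module R M]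
    (c i : ℕ) : ℕ∞ :=
  relLength (formsIn E ^ (i + c) • constants R r M)
    ((formsIn E ^ i * allForms R r ^ c) • constants R r M)

variable {M : Type*} [AddCommGroup M] [Module R M]

theorem relLength_smul_constants_le (I : Ideal R) :
    relLength (I • constants R r M) (constants R r M) ≤ relLength (I • (⊤ : Submodule R M)) ⊤ := by
  rw [constants, LinearMap.range_eq_map, ← Submodule.map_smul'']
  exact relLength_map_map_le _ _ _

theorem allForms_eq_span : allForms R r = Submodule.span R (Set.range MvPolynomial.X) :=
  MvPolynomial.homogeneousSubmodule_one_eq_span_X ..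

theorem relLength_smul_allForms_pow_le (I : Ideal R) (n : ℕ)
    (V : Submodule R (MvPolynomial (Fin r) R ⊗[R] M)) :
    relLength (I • allForms R r ^ n • V) (allForms R r ^ n • V) ≤
      (Nat.multichoose r n : ℕ) * relLength (I • V) V := by
  rw [← idealIn_smul (B := MvPolynomial (Fin r) R) I,
    ← idealIn_smul (B := MvPolynomial (Fin r) R) I]
  have h := relLength_smul_pow_smul_le (W := MvPolynomial (Fin r) R ⊗[R] M)
    (allForms_eq_span (R := R) (r := r)) n (idealIn _ I) V
  rwa [Fintype.card_fin] at h

section Exact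

variable {M₁ M₂ M₃ : Type*} [AddCommGroup M₁] [Module R M₁] [AddCommGroup M₂] [Module R M₂]
  [AddCommGroup M₃] [Module R M₃] {f : M₁ →ₗ[R] M₂} {g : M₂ →ₗ[R] M₃}

/-- The kernel of `W₂ → W₃`, for `Wᵢ = R[X] ⊗ Mᵢ`, is the image of `W₁`, so it carries the part of
the length that `M₃` does not see. -/
theorem relLength_eq_add_of_exact (hg : Function.Surjective g) (hfg : Function.Exact f g)
    {P Q : Submodule R (MvPolynomial (Fin r) R)} (hPQ : P ≤ Q) :
    relLength (P • constants R r M₂) (Q • constants R r M₂) =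
      relLength (P • constants R r M₂) (Q • constants R r M₂ ⊓
        LinearMap.range (f.lTensor (MvPolynomial (Fin r) R))) +
      relLength (P • constants R r M₃) (Q • constants R r M₃) := by
  have hle : P • constants R r M₂ ≤ Q • constants R r M₂ := Submodule.smul_mono_left hPQ
  rw [relLength_eq_add (le_sup_left : P • constants R r M₂ ≤ P • constants R r M₂ ⊔
    LinearMap.range (f.lTensor (MvPolynomial (Fin r) R)))]
  congr 1
  · rw [sup_inf_assoc_of_le _ hle, relLength_sup, inf_comm]
  · rw [← map_lTensor_smul_of_surjective hg, ← map_lTensor_smul_of_surjective hg, relLength_map,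
      Submodule.comap_map_eq, LinearMap.exact_iff.1 (lTensor_exact _ hfg hg)]

theorem allForms_pow_smul_inf_range_le (f : M₁ →ₗ[R] M₂) (n : ℕ) :
    allForms R r ^ n • constants R r M₂ ⊓ LinearMap.range (f.lTensor (MvPolynomial (Fin r) R)) ≤
      (allForms R r ^ n • constants R r M₁).map (f.lTensor (MvPolynomial (Fin r) R)) := by
  rintro _ ⟨hw, v, rfl⟩
  refine ⟨component M₁ n v, component_mem n v, ?_⟩
  rw [← component_lTensor, component_eq_self hw]

/-- The length for `M₂` is at most the sum of those for `M₁` and `M₃`, because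
`F^n M₂ ∩ W₁ = F^n M₁` and `E^n M₁ ⊆ E^n M₂ ∩ W₁`. -/
theorem reesLength_le_add (hg : Function.Surjective g) (hfg : Function.Exact f g)
    (E : Submodule R (Fin r → R)) (n : ℕ) :
    reesLength E M₂ n ≤ reesLength E M₁ n + reesLength E M₃ n := by
  rw [reesLength, relLength_eq_add_of_exact hg hfg (pow_le_pow_left' (formsIn_le E) n)]
  refine add_le_add ?_ le_rfl
  refine (relLength_mono (allForms_pow_smul_inf_range_le f n)).trans ?_
  exact (relLength_anti (map_lTensor_smul f _)).trans (relLength_map_map_le _ _ _)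

variable [IsNoetherianRing R]

theorem exists_gapLength_le_add [Module.Finite R M₂] (hg : Function.Surjective g)
    (hfg : Function.Exact f g) (E : Submodule R (Fin r → R)) :
    ∃ a, ∀ c i, a ≤ i →
      gapLength E M₂ c i ≤ gapLength E M₁ (c + a) (i - a) + gapLength E M₃ c i := by
  obtain ⟨a, ha⟩ := exists_pow_mul_inf_range_le (M := M₂) f E
  refine ⟨a, fun c i hai => ?_⟩
  have hle : formsIn E ^ (i + c) ≤ formsIn E ^ i * allForms R r ^ c := by
    rw [pow_add]
    exact mul_le_mul_right (pow_le_pow_left' (formsIn_le E) c) _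
  rw [gapLength, relLength_eq_add_of_exact hg hfg hle]
  refine add_le_add ?_ le_rfl
  refine (relLength_mono (ha i c hai)).trans ?_
  refine le_trans (relLength_anti (map_lTensor_smul f _)) (relLength_map_map_le _ _ _) |>.trans ?_
  rw [gapLength, show i - a + (c + a) = i + c by omega]

/-- The defect of additivity is the length of `(E^n M₂ ∩ W₁) / E^n M₁`. By the Artin–Rees lemma it
is at most that of `E^(n-a) F^a M₁ / E^n M₁`. -/
theorem exists_reesLength_add_le [Module.Finite R M₂] (hf : Function.Injective f)
    (hg : Function.Surjective g) (hfg : Function.Exact f g) (E : Submodule R (Fin r → R)) :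
    ∃ a, ∀ n, a ≤ n →
      reesLength E M₁ n + reesLength E M₃ n ≤ reesLength E M₂ n + gapLength E M₁ a (n - a) := by
  obtain ⟨a, ha⟩ := exists_pow_mul_inf_range_le (M := M₂) f E
  refine ⟨a, fun n han => ?_⟩
  have hinj : Function.Injective (f.lTensor (MvPolynomial (Fin r) R)) :=
    Module.Flat.lTensor_preserves_injective_linearMap f hf
  rw [reesLength, reesLength, reesLength,
    relLength_eq_add_of_exact hg hfg (pow_le_pow_left' (formsIn_le E) n), add_right_comm]
  refine add_le_add ?_ le_rfl
  rw [← relLength_map_map_of_injective hinj, relLength_eq_add (map_lTensor_smul f (formsIn E ^ n)),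
    add_comm]
  refine add_le_add (relLength_mono (le_inf (map_lTensor_smul f _) LinearMap.map_le_range)) ?_
  have h1 := ha n 0 han
  rw [pow_zero, mul_one, zero_add] at h1
  rw [gapLength, show n - a + a = n by omega, ← relLength_map_map_of_injective hinj]
  exact relLength_mono ((inf_le_inf_left _ LinearMap.map_le_range).trans h1)

end Exact

end Growth

/-! ### Growth of the lengths of Rees quotients -/

section Superadditive

variable {R : Type*} [CommRing R]

/-- Superadditivity of `t ↦ λ(U / I^t U)` coming from a nonzerodivisor `y ∈ I^K`. -/
theorem mul_relLength_le_of_smul_mem {W : Type*} [AddCommGroup W] [Module R W]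
    {U : Submodule R W} {I : Ideal R} {K c : ℕ} (hKc : K ≤ c) {y : R} (hyI : y ∈ I ^ K)
    (hc : ∀ t, c ≤ t → ∀ u ∈ U, y • u ∈ I ^ t • U → u ∈ I ^ (t - c) • U) (s : ℕ) :
    (s : ℕ∞) * relLength (I ^ K • U) U ≤ relLength (I ^ (c * s) • U) U := by
  induction s with
  | zero => simp
  | succ s ih =>
    set t := c * (s + 1) with ht
    have hct : c ≤ t := Nat.le_mul_of_pos_right c (Nat.succ_pos s)
    have hts : t - c = c * s := by rw [ht, Nat.mul_succ, Nat.add_sub_cancel]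
    have hle : I ^ t • U ⊔ U.map (LinearMap.lsmul R W y) ≤ I ^ K • U := by
      refine sup_le (Submodule.smul_mono_left (Ideal.pow_le_pow_right (hKc.trans hct))) ?_
      rintro _ ⟨u, hu, rfl⟩
      exact Submodule.smul_mem_smul hyI hu
    rw [relLength_add (le_sup_left : I ^ t • U ≤ I ^ t • U ⊔ U.map (LinearMap.lsmul R W y))
      (hle.trans Submodule.smul_le_right), Nat.cast_succ, add_mul, one_mul]
    refine add_le_add (ih.trans ?_) (relLength_anti hle)
    rw [relLength_sup, relLength_map, ← relLength_inf (Submodule.comap _ _)]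
    refine relLength_anti ?_
    rintro u ⟨hu, huU⟩
    rw [← hts]
    exact hc t hct u huU hu

end Superadditive

section LocalGrowth

open IsLocalRing

variable {R : Type*} [CommRing R] [IsLocalRing R] {r : ℕ} {M : Type*} [AddCommGroup M] [Module R M]

theorem idealIn_pow_mul_allForms_le {E : Submodule R (Fin r → R)} {k : ℕ}
    (hk : maximalIdeal R ^ k • (⊤ : Submodule R (Fin r → R)) ≤ E) :
    idealIn (MvPolynomial (Fin r) R) (maximalIdeal R ^ k) * allForms R r ≤ formsIn E := by
  rw [← smul_eq_mul, idealIn_smul, allForms_eq_range, LinearMap.range_eq_map,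
    ← Submodule.map_smul'']
  exact Submodule.map_mono hk

theorem pow_smul_allForms_pow_smul_le {E : Submodule R (Fin r → R)} {k : ℕ}
    (hk : maximalIdeal R ^ k • (⊤ : Submodule R (Fin r → R)) ≤ E) (n : ℕ)
    (V : Submodule R (MvPolynomial (Fin r) R ⊗[R] M)) :
    maximalIdeal R ^ (k * n) • allForms R r ^ n • V ≤ formsIn E ^ n • V := by
  rw [← idealIn_smul (B := MvPolynomial (Fin r) R), smul_smul_eq, pow_mul, idealIn_pow, ← mul_pow]
  exact Submodule.smul_mono_left (pow_le_pow_left' (idealIn_pow_mul_allForms_le hk) n)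

theorem relLength_pow_smul_allForms_pow_le {e C : ℕ}
    (hC : ∀ t, relLength (maximalIdeal R ^ t • (⊤ : Submodule R M)) ⊤ ≤ (C * (t + 1) ^ e : ℕ))
    (a n : ℕ) :
    relLength (maximalIdeal R ^ (a * n) • allForms R r ^ n • constants R r M)
        (allForms R r ^ n • constants R r M) ≤
      ((r + 1) ^ (r - 1) * C * (a + 1) ^ e * (n + 1) ^ (r - 1 + e) : ℕ) := by
  refine (relLength_smul_allForms_pow_le _ n _).trans ?_
  refine (mul_le_mul_right ((relLength_smul_constants_le _).trans (hC (a * n))) _).trans ?_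
  norm_cast
  calc Nat.multichoose r n * (C * (a * n + 1) ^ e)
      ≤ ((r + 1) ^ (r - 1) * (n + 1) ^ (r - 1)) * (C * ((a + 1) * (n + 1)) ^ e) := by
        gcongr
        · exact (multichoose_le_pow r n).trans (add_pow_le_mul_pow r n (r - 1))
        · nlinarith
    _ = _ := by
        rw [mul_pow, pow_add]
        ring

/-- The length of `F^n M / E^n M` is `O(n^(r-1+e))` when the Hilbert–Samuel function of `M` is
`O(t^e)`, because `E^n` contains `𝔪^(kn) F^n`. -/
theorem exists_reesLength_le {E : Submodule R (Fin r → R)} {k : ℕ}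
    (hk : maximalIdeal R ^ k • (⊤ : Submodule R (Fin r → R)) ≤ E) {e C : ℕ}
    (hC : ∀ t, relLength (maximalIdeal R ^ t • (⊤ : Submodule R M)) ⊤ ≤ (C * (t + 1) ^ e : ℕ)) :
    ∃ D : ℕ, ∀ n, reesLength E M n ≤ (D * (n + 1) ^ (r - 1 + e) : ℕ) :=
  ⟨(r + 1) ^ (r - 1) * C * (k + 1) ^ e, fun n =>
    (relLength_anti (pow_smul_allForms_pow_smul_le hk n _)).trans
      (relLength_pow_smul_allForms_pow_le hC k n)⟩

/-- Modulo `𝔪 F`, a proper submodule `E` is generated by `s < r` elements: by Nakayama's lemma its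
image in the vector space `F / 𝔪 F` of dimension `r` is a proper subspace. -/
theorem exists_forms_generating_modulo (E : Submodule R (Fin r → R)) (hE : E ≠ ⊤) :
    ∃ s < r, ∃ g : Fin s → MvPolynomial (Fin r) R,
      formsIn E ≤ Submodule.span R (Set.range g) ⊔
        idealIn (MvPolynomial (Fin r) R) (maximalIdeal R) * allForms R r := by
  let φ : (Fin r → R) →ₗ[R] (Fin r → ResidueField R) :=
    (Algebra.linearMap R (ResidueField R)).compLeft (Fin r)
  have hker : LinearMap.ker φ ≤ maximalIdeal R • (⊤ : Submodule R (Fin r → R)) := by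
    intro v hv
    rw [pi_eq_sum_univ v]
    refine Submodule.sum_mem _ fun i _ => Submodule.smul_mem_smul ?_ trivial
    have : φ v i = 0 := by rw [LinearMap.mem_ker.1 hv]; rfl
    exact (residue_eq_zero_iff _).1 this
  let Ebar : Submodule (ResidueField R) (Fin r → ResidueField R) :=
    Submodule.span (ResidueField R) (φ '' E)
  have hlift : ∀ w ∈ Ebar, ∃ v ∈ E, φ v = w := by
    intro w hw
    induction hw using Submodule.span_induction with
    | mem w hw => exact hw
    | zero => exact ⟨0, E.zero_mem, map_zero φ⟩
    | add v w _ _ hv hw =>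
      obtain ⟨v, hv, rfl⟩ := hv
      obtain ⟨w, hw, rfl⟩ := hw
      exact ⟨v + w, E.add_mem hv hw, map_add φ v w⟩
    | smul a w _ hw =>
      obtain ⟨a, rfl⟩ := residue_surjective a
      obtain ⟨w, hw, rfl⟩ := hw
      exact ⟨a • w, E.smul_mem a hw, map_smul φ a w⟩
  have hEbar : Ebar ≠ ⊤ := by
    intro h
    refine hE (top_le_iff.1 (Submodule.le_of_le_smul_of_le_jacobson_bot (I := maximalIdeal R)
      Module.Finite.fg_top (maximalIdeal_le_jacobson _) fun v _ => ?_))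
    obtain ⟨w, hw, hwv⟩ := hlift (φ v) (h ▸ trivial)
    rw [← add_sub_cancel w v]
    refine Submodule.add_mem_sup hw (hker ?_)
    rw [LinearMap.mem_ker, map_sub, hwv, sub_self]
  have hs : Module.finrank (ResidueField R) Ebar < r := by
    have := Submodule.finrank_lt hEbar
    rwa [Module.finrank_fin_fun] at this
  let b := Module.finBasis (ResidueField R) Ebar
  choose w hwE hwb using fun j => hlift (b j) (b j).2
  refine ⟨_, hs, fun j => linearForm R r (w j), ?_⟩
  rw [formsIn, Submodule.map_le_iff_le_comap]
  intro v hv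
  let v' : Ebar := ⟨φ v, Submodule.subset_span ⟨v, hv, rfl⟩⟩
  choose a ha using fun j => residue_surjective (b.repr v' j)
  have hv' : v - ∑ j, a j • w j ∈ LinearMap.ker φ := by
    have h1 : φ v = ∑ j, b.repr v' j • (b j : Fin r → ResidueField R) := by
      have := congrArg Ebar.subtype (b.sum_repr v')
      rw [map_sum] at this
      exact this.symm
    rw [LinearMap.mem_ker, map_sub, map_sum, h1, sub_eq_zero]
    refine Finset.sum_congr rfl fun j _ => ?_
    rw [map_smul, hwb, ← ha]
    rfl
  rw [Submodule.mem_comap, ← add_sub_cancel (∑ j, a j • w j) v, map_add]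
  refine Submodule.add_mem_sup ?_ ?_
  · rw [map_sum]
    refine Submodule.sum_mem _ fun j _ => ?_
    rw [map_smul]
    exact Submodule.smul_mem _ _ (Submodule.subset_span ⟨j, rfl⟩)
  · rw [← smul_eq_mul, idealIn_smul, allForms_eq_range, LinearMap.range_eq_map,
      ← Submodule.map_smul'']
    exact ⟨_, hker hv', rfl⟩

/-- The bound for `E^i F^c M / E^(i+c) M` when `𝔪 M = 0`: modulo `𝔪 F`, the proper submodule `E`
is generated by fewer than `r` elements. -/
theorem isLowerOrder_gapLength_of_smul_eq_zero {E : Submodule R (Fin r → R)} (hE : E ≠ ⊤) {e C : ℕ}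
    (hC : ∀ t, relLength (maximalIdeal R ^ t • (⊤ : Submodule R M)) ⊤ ≤ (C * (t + 1) ^ e : ℕ))
    (hM : ∀ x ∈ maximalIdeal R, ∀ m : M, x • m = 0) (c : ℕ) :
    IsLowerOrder (r - 1 + e) (gapLength E M c) := by
  obtain ⟨s, hs, g, hg⟩ := exists_forms_generating_modulo E hE
  set G := Submodule.span R (Set.range g) with hG
  set J := idealIn (MvPolynomial (Fin r) R) (maximalIdeal R) with hJ
  have hJV : J • constants R r M = ⊥ := by
    rw [hJ, idealIn_smul, eq_bot_iff, Submodule.smul_le]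
    rintro x hx _ ⟨m, rfl⟩
    rw [← map_smul, hM x hx, map_zero]
    exact zero_mem _
  have hJP : ∀ P : Submodule R (MvPolynomial (Fin r) R), J • P • constants R r M = ⊥ := by
    intro P
    rw [smul_smul_eq, mul_comm, ← smul_smul_eq, hJV, Submodule.smul_bot]
  have hpow : ∀ (i : ℕ) (P : Submodule R (MvPolynomial (Fin r) R)),
      (formsIn E ^ i * P) • constants R r M ≤ (G ^ i * P) • constants R r M := by
    intro i
    induction i with
    | zero => simp
    | succ i ih =>
      intro P
      rw [pow_succ, mul_assoc]
      refine (ih (formsIn E * P)).trans ?_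
      rw [mul_left_comm, ← smul_smul_eq]
      refine (Submodule.smul_mono_left hg).trans ?_
      rw [Submodule.sup_smul, ← smul_smul_eq J, smul_smul_eq (allForms R r), hJP, sup_bot_eq,
        smul_smul_eq, ← mul_assoc, ← pow_succ']
  have hlen : ∀ i, gapLength E M c i ≤ (Nat.multichoose s i : ℕ) *
      ((Nat.multichoose r c : ℕ) * (C * (1 + 1) ^ e : ℕ)) := by
    intro i
    refine (relLength_anti bot_le).trans ((relLength_mono (hpow i _)).trans ?_)
    have h1 := relLength_smul_pow_smul_le (W := MvPolynomial (Fin r) R ⊗[R] M) hG i J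
      (allForms R r ^ c • constants R r M)
    have h2 := relLength_smul_allForms_pow_le (maximalIdeal R) c (constants R r M)
    rw [← idealIn_smul (B := MvPolynomial (Fin r) R), ← idealIn_smul (B := MvPolynomial (Fin r) R),
      ← hJ, hJV, hJP] at h2
    rw [smul_smul_eq (G ^ i), hJP, hJP, Fintype.card_fin] at h1
    refine h1.trans (mul_le_mul_right (h2.trans (mul_le_mul_right ?_ _)) _)
    have h3 := (relLength_smul_constants_le (r := r) (maximalIdeal R ^ 1)).trans (hC 1)
    rwa [pow_one, ← idealIn_smul (B := MvPolynomial (Fin r) R), ← hJ, hJV] at h3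
  -- `i * multichoose s i` is `O(i^s)`, and `s ≤ r - 1`.
  refine ⟨(s + 1) ^ s * (Nat.multichoose r c * (C * (1 + 1) ^ e)), Eventually.of_forall fun i => ?_⟩
  refine (mul_le_mul_right (hlen i) _).trans ?_
  norm_cast
  calc i * (Nat.multichoose s i * (Nat.multichoose r c * (C * (1 + 1) ^ e)))
      = (i * Nat.multichoose s i) * (Nat.multichoose r c * (C * (1 + 1) ^ e)) := by ring
    _ ≤ ((s + 1) ^ s * (i + 1) ^ (r - 1 + e)) * (Nat.multichoose r c * (C * (1 + 1) ^ e)) := by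
        refine Nat.mul_le_mul_right _ ((mul_multichoose_le s i).trans ?_)
        exact Nat.mul_le_mul_left _ (Nat.pow_le_pow_right (by omega) (by omega))
    _ = _ := by ring

variable [IsNoetherianRing R]

/-- The bound for `E^i F^c M / E^(i+c) M` when the maximal ideal contains a nonzerodivisor
on `M`: the function `g(t) = λ(E^i M / 𝔪^t E^i M)` satisfies `i * g(K) ≤ g(c * i)`, with `c`
independent of `i`, and `g(c * i)` is at most of the order of the length of `F^i M / E^i M`. -/
theorem isLowerOrder_gapLength_of_injective [Module.Finite R M] {E : Submodule R (Fin r → R)}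
    {k : ℕ} (hk : maximalIdeal R ^ k • (⊤ : Submodule R (Fin r → R)) ≤ E) {e C : ℕ}
    (hC : ∀ t, relLength (maximalIdeal R ^ t • (⊤ : Submodule R M)) ⊤ ≤ (C * (t + 1) ^ e : ℕ))
    {x : R} (hx : x ∈ maximalIdeal R) (hxM : Function.Injective fun m : M => x • m) (c : ℕ) :
    IsLowerOrder (r - 1 + e) (gapLength E M c) := by
  -- `𝔪^K F^c ⊆ E^c`, so the gap is controlled by `E^i M / 𝔪^K E^i M`.
  set K := k * c with hK
  have hyM : Function.Injective fun m : M => x ^ K • m := by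
    have : (fun m : M => x ^ K • m) = (fun m : M => x • m)^[K] := by
      rw [smul_iterate]
    rw [this]
    exact hxM.iterate K
  obtain ⟨c₀, hc₀⟩ := exists_mem_pow_smul_of_smul_mem E (maximalIdeal R) hyM
  have hgap : ∀ i, gapLength E M c i ≤ (Nat.multichoose r c : ℕ) *
      relLength (maximalIdeal R ^ K • formsIn E ^ i • constants R r M)
        (formsIn E ^ i • constants R r M) := by
    intro i
    refine le_trans ?_ (relLength_smul_allForms_pow_le (maximalIdeal R ^ K) c _)
    rw [gapLength, smul_smul_eq (allForms R r ^ c), mul_comm (allForms R r ^ c)]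
    refine relLength_anti ?_
    rw [pow_add, mul_comm (formsIn E ^ i), mul_comm (formsIn E ^ i), ← smul_smul_eq,
      ← smul_smul_eq]
    exact pow_smul_allForms_pow_smul_le hk c _
  refine IsLowerOrder.mono (IsLowerOrder.const_mul ?_ (Nat.multichoose r c))
    (Eventually.of_forall hgap)
  refine ⟨(r + 1) ^ (r - 1) * C * (c₀ + K + k + 1) ^ e, Eventually.of_forall fun i => ?_⟩
  have hmul := mul_relLength_le_of_smul_mem (U := formsIn E ^ i • constants R r M)
    (I := maximalIdeal R) (K := K) (c := c₀ + K) (Nat.le_add_left K c₀) (Ideal.pow_mem_pow hx K)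
    (fun t ht u hu hyu => Submodule.smul_mono_left (Ideal.pow_le_pow_right (by omega))
      (hc₀ t i (by omega) u hu hyu)) i
  refine hmul.trans ((relLength_mono ?_).trans ((relLength_anti ?_).trans
    (relLength_pow_smul_allForms_pow_le hC (c₀ + K + k) i)))
  · exact Submodule.smul_mono_left (pow_le_pow_left' (formsIn_le E) i)
  · rw [add_mul, pow_add, mul_smul]
    exact Submodule.smul_mono le_rfl (pow_smul_allForms_pow_smul_le hk i _)

theorem isLowerOrder_gapLength {E : Submodule R (Fin r → R)} (hE : E ≠ ⊤)
    {k : ℕ} (hk : maximalIdeal R ^ k • (⊤ : Submodule R (Fin r → R)) ≤ E) {d : ℕ}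
    (hd : ringKrullDim R ≤ d) (N : Type*) [AddCommGroup N] [Module R N] [hN : Module.Finite R N]
    (c : ℕ) : IsLowerOrder (r - 1 + d) (gapLength E N c) := by
  induction hN using IsNoetherianRing.induction_on_isQuotientEquivQuotientPrime R
    generalizing c with
  | subsingleton N =>
    refine ⟨0, Eventually.of_forall fun i => ?_⟩
    have : Subsingleton (MvPolynomial (Fin r) R ⊗[R] N) := inferInstance
    rw [gapLength, relLength_eq_zero (le_of_eq (Subsingleton.elim _ _))]
    simp
  | quotient N p f =>
    obtain ⟨C, hC⟩ := exists_relLength_pow_le hd N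
    by_cases hp : maximalIdeal R ≤ p.1
    · refine isLowerOrder_gapLength_of_smul_eq_zero hE hC (fun x hx m => ?_) c
      apply f.injective
      rw [map_smul, map_zero]
      obtain ⟨b, hb⟩ := Ideal.Quotient.mk_surjective (f m)
      rw [← hb, ← Ideal.Quotient.mk_eq_mk, ← Submodule.Quotient.mk_smul]
      exact (Submodule.Quotient.mk_eq_zero p.1).2 (p.1.mul_mem_right b (hp hx))
    · obtain ⟨x, hx, hxp⟩ := Set.not_subset.1 hp
      refine isLowerOrder_gapLength_of_injective hk hC hx (fun m₁ m₂ h => ?_) c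
      apply f.injective
      have h1 : x • (f m₁ - f m₂) = 0 := by
        rw [smul_sub, ← map_smul, ← map_smul, sub_eq_zero]
        exact congrArg f h
      obtain ⟨b, hb⟩ := Ideal.Quotient.mk_surjective (f m₁ - f m₂)
      rw [← sub_eq_zero, ← hb, Ideal.Quotient.eq_zero_iff_mem]
      rw [← hb, ← Ideal.Quotient.mk_eq_mk, ← Submodule.Quotient.mk_smul,
        Submodule.Quotient.mk_eq_zero, smul_eq_mul] at h1
      exact (p.2.mem_or_mem h1).resolve_left hxp
  | exact N₁ N₂ N₃ f g hf hg hfg h₁ h₃ =>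
    obtain ⟨a, ha⟩ := exists_gapLength_le_add (r := r) hg hfg E
    refine (((h₁ (c + a)).shift a).add (h₃ c)).mono ?_
    filter_upwards [eventually_ge_atTop a] with i hi
    exact ha c i hi

end LocalGrowth

/-! ### Existence and additivity of the multiplicity -/

section Limits

open Polynomial in
/-- An eventually polynomial function that is `O(n^e)` agrees for large `n` with a polynomial of
degree at most `e`, so its quotient by `n^e` converges. -/
theorem exists_tendsto_div_pow_of_eventually_eq_eval {f : ℕ → ℕ} {p : ℚ[X]}
    (hp : ∀ᶠ n : ℕ in atTop, (f n : ℚ) = p.eval (n : ℚ)) {D e : ℕ}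
    (hf : ∀ n, f n ≤ D * (n + 1) ^ e) :
    ∃ c : ℝ, Tendsto (fun n : ℕ => (f n : ℝ) / (n : ℝ) ^ e) atTop (𝓝 c) := by
  set P : ℝ[X] := p.map (algebraMap ℚ ℝ) with hPdef
  have hP : ∀ᶠ n : ℕ in atTop,
      P.eval (n : ℝ) / (X ^ e : ℝ[X]).eval (n : ℝ) = (f n : ℝ) / (n : ℝ) ^ e := by
    filter_upwards [hp] with n hn
    rw [hPdef, eval_natCast_map, ← hn, eval_pow, eval_X, eq_ratCast, Rat.cast_natCast]
  have key : ∀ {l : Filter ℝ}, Tendsto (fun x => P.eval x / (X ^ e : ℝ[X]).eval x) atTop l →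
      Tendsto (fun n : ℕ => (f n : ℝ) / (n : ℝ) ^ e) atTop l := fun h =>
    (h.comp tendsto_natCast_atTop_atTop).congr' hP
  rcases lt_trichotomy P.degree (X ^ e : ℝ[X]).degree with h | h | h
  · exact ⟨0, key (div_tendsto_atTop_zero_of_degree_lt _ _ h)⟩
  · exact ⟨_, key (div_tendsto_atTop_leadingCoeff_div_of_degree_eq _ _ h)⟩
  · exfalso
    have h1 := ((abs_div_tendsto_atTop_atTop_of_degree_gt P (X ^ e) h
      (pow_ne_zero _ X_ne_zero)).comp
      (tendsto_natCast_atTop_atTop (R := ℝ)))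
    obtain ⟨n, hn, hfn, hn1⟩ := ((h1.eventually_gt_atTop ((D : ℝ) * 2 ^ e)).and
      (hP.and (eventually_ge_atTop 1))).exists
    simp only [Function.comp_apply] at hn
    rw [hfn, abs_of_nonneg (by positivity)] at hn
    have hn0 : (0 : ℝ) < (n : ℝ) ^ e := by positivity
    rw [lt_div_iff₀ hn0] at hn
    have h2 : f n ≤ D * 2 ^ e * n ^ e := by
      refine (hf n).trans ?_
      rw [mul_assoc, ← mul_pow]
      gcongr
      omega
    have h3 : (f n : ℝ) ≤ D * 2 ^ e * n ^ e := by exact_mod_cast h2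
    linarith

theorem IsLowerOrder.eventually_ne_top {e : ℕ} {z : ℕ → ℕ∞} (hz : IsLowerOrder e z) :
    ∀ᶠ n in atTop, z n ≠ ⊤ := by
  obtain ⟨C, hC⟩ := hz
  filter_upwards [hC, eventually_ge_atTop 1] with n hn hn1 htop
  rw [htop, ENat.mul_top (by exact_mod_cast (by omega : n ≠ 0)), top_le_iff] at hn
  exact ENat.natCast_ne_top _ hn

theorem IsLowerOrder.tendsto_div_pow {e : ℕ} {z : ℕ → ℕ∞} (hz : IsLowerOrder e z) :
    Tendsto (fun n : ℕ => ((z n).toNat : ℝ) / (n : ℝ) ^ e) atTop (𝓝 0) := by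
  obtain ⟨C, hC⟩ := hz
  have h0 : Tendsto (fun n : ℕ => ((C * 2 ^ e : ℕ) : ℝ) / (n : ℝ)) atTop (𝓝 0) :=
    tendsto_const_div_atTop_nhds_zero_nat _
  refine squeeze_zero' (Eventually.of_forall fun n => by positivity) ?_ h0
  filter_upwards [hC, eventually_ge_atTop 1] with n hn hn1
  have h1 : n * (z n).toNat ≤ C * (n + 1) ^ e := by
    have := ENat.toNat_le_of_le_natCast hn
    rwa [ENat.toNat_mul, ENat.toNat_natCast] at this
  have h2 : n * (z n).toNat ≤ C * 2 ^ e * n ^ e := by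
    refine h1.trans ?_
    rw [mul_assoc, ← mul_pow]
    gcongr
    omega
  have h3 : (n : ℝ) * (z n).toNat ≤ ((C * 2 ^ e : ℕ) : ℝ) * n ^ e := by exact_mod_cast h2
  have hn0 : (0 : ℝ) < n := by exact_mod_cast hn1
  rw [div_le_div_iff₀ (by positivity) hn0]
  linarith

end Limits

section Multiplicity

open IsLocalRing

variable {R : Type*} [CommRing R] {r : ℕ} {E : Submodule R (Fin r → R)}
  {M : Type*} [AddCommGroup M] [Module R M]

theorem brLength_eq_reesLength (E : Submodule R (Fin r → R)) (M : Type*) [AddCommGroup M]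
    [Module R M] (n : ℕ) : brLength E M n = reesLength E M n :=
  brLength_eq_relLength E n

theorem brSeq_eq_zero (h : ∀ n, brLength E M n = 0) : brSeq E M = fun _ => 0 := by
  funext n
  simp [brSeq, h]

theorem br_eq_zero (h : ∀ n, brLength E M n = 0) : br E M = 0 := by
  rw [br, brSeq_eq_zero h]
  exact tendsto_const_nhds.limUnder_eq

theorem brDefined_of_eq_zero (h : ∀ n, brLength E M n = 0) : BrDefined E M := by
  refine ⟨fun n => by simp [h], ?_⟩
  rw [br_eq_zero h, brSeq_eq_zero h]
  exact tendsto_const_nhds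

theorem brLength_top (n : ℕ) : brLength (⊤ : Submodule R (Fin r → R)) M n = 0 := by
  rw [brLength_eq_reesLength, reesLength, relLength_eq_zero]
  rw [allForms_eq_range, formsIn, LinearMap.range_eq_map]

theorem brLength_of_subsingleton [Subsingleton M] (n : ℕ) : brLength E M n = 0 := by
  have : Subsingleton (MvPolynomial (Fin r) R ⊗[R] M) := inferInstance
  rw [brLength_eq_reesLength, reesLength, relLength_eq_zero (le_of_eq (Subsingleton.elim _ _))]

/-- For `r = 0` the only submodule is `⊤`. Hence the truncated subtraction in `dim R + r - 1` does
not matter when `E ≠ ⊤`. -/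
theorem pos_of_ne_top (hE : E ≠ ⊤) : 0 < r := by
  rcases r with _ | r
  · exact absurd (Subsingleton.elim E ⊤) hE
  · exact r.succ_pos

theorem brSeq_eq (hE : E ≠ ⊤) (n : ℕ) : brSeq E M n = ((dimNat R + r - 1).factorial : ℝ) *
    (((brLength E M n).toNat : ℝ) / (n : ℝ) ^ (r - 1 + dimNat R)) := by
  have := pos_of_ne_top hE
  rw [brSeq, mul_div_assoc, show r - 1 + dimNat R = dimNat R + r - 1 by omega]

theorem br_eq_zero_of_isLowerOrder (hE : E ≠ ⊤)
    (h : IsLowerOrder (r - 1 + dimNat R) (reesLength E M)) : br E M = 0 := by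
  have h1 := h.tendsto_div_pow.const_mul ((dimNat R + r - 1).factorial : ℝ)
  rw [mul_zero] at h1
  refine Tendsto.limUnder_eq (h1.congr fun n => ?_)
  rw [brSeq_eq hE, brLength_eq_reesLength]

variable [IsNoetherianRing R] [IsLocalRing R]

theorem exists_tendsto_brLength_div [Module.Finite R M]
    (hE : Module.length R ((Fin r → R) ⧸ E) ≠ ⊤) :
    (∀ n, brLength E M n ≠ ⊤) ∧ ∃ c : ℝ, Tendsto (fun n : ℕ => ((brLength E M n).toNat : ℝ) /
      (n : ℝ) ^ (r - 1 + dimNat R)) atTop (𝓝 c) := by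
  obtain ⟨k, hk⟩ := exists_pow_smul_top_le hE
  obtain ⟨C, hC⟩ := exists_relLength_pow_le (coe_dimNat (R := R)).ge M
  obtain ⟨D, hD⟩ := exists_reesLength_le hk hC
  have hfin : ∀ n, reesLength E M n ≠ ⊤ := fun n =>
    ne_top_of_le_ne_top (ENat.natCast_ne_top _) (hD n)
  obtain ⟨p, hp⟩ := exists_polynomial_relLength_pow_smul (formsIn_le E) (formsIn_fg E)
    (allForms_fg) (constants_fg (R := R) (r := r) (M := M)) hfin
  simp only [brLength_eq_reesLength]
  exact ⟨hfin, exists_tendsto_div_pow_of_eventually_eq_eval hp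
    fun n => ENat.toNat_le_of_le_natCast (hD n)⟩

theorem brDefined [Module.Finite R M] (hE : Module.length R ((Fin r → R) ⧸ E) ≠ ⊤) :
    BrDefined E M := by
  by_cases htop : E = ⊤
  · subst htop
    exact brDefined_of_eq_zero brLength_top
  · obtain ⟨hfin, c, hc⟩ := exists_tendsto_brLength_div (M := M) hE
    refine ⟨hfin, tendsto_nhds_limUnder ⟨((dimNat R + r - 1).factorial : ℝ) * c, ?_⟩⟩
    exact (hc.const_mul _).congr fun n => (brSeq_eq htop n).symm

/-- The multiplicity is additive on short exact sequences: the lengths are additive up to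
`gapLength`, whose order of growth is lower. -/
theorem br_eq_add_of_exact {M₁ M₂ M₃ : Type*} [AddCommGroup M₁] [Module R M₁] [AddCommGroup M₂]
    [Module R M₂] [AddCommGroup M₃] [Module R M₃] [Module.Finite R M₁] [Module.Finite R M₂]
    [Module.Finite R M₃] {f : M₁ →ₗ[R] M₂} {g : M₂ →ₗ[R] M₃} (hf : Function.Injective f)
    (hg : Function.Surjective g) (hfg : Function.Exact f g)
    (hE : Module.length R ((Fin r → R) ⧸ E) ≠ ⊤) : br E M₂ = br E M₁ + br E M₃ := by
  by_cases htop : E = ⊤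
  · subst htop
    rw [br_eq_zero brLength_top, br_eq_zero brLength_top, br_eq_zero brLength_top, add_zero]
  obtain ⟨k, hk⟩ := exists_pow_smul_top_le hE
  obtain ⟨a, ha⟩ := exists_reesLength_add_le hf hg hfg E
  have hgap := (isLowerOrder_gapLength htop hk (coe_dimNat (R := R)).ge M₁ a).shift a
  have hlim : Tendsto (fun n => brSeq E M₁ n + brSeq E M₃ n - brSeq E M₂ n) atTop (𝓝 0) := by
    have h0 := hgap.tendsto_div_pow.const_mul ((dimNat R + r - 1).factorial : ℝ)
    rw [mul_zero] at h0
    refine squeeze_zero' ?_ ?_ h0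
    · refine Eventually.of_forall fun n => ?_
      have h1 := reesLength_le_add hg hfg E n
      simp only [← brLength_eq_reesLength] at h1
      rw [← ENat.natCast_toNat ((brDefined (M := M₁) hE).1 n),
        ← ENat.natCast_toNat ((brDefined (M := M₂) hE).1 n),
        ← ENat.natCast_toNat ((brDefined (M := M₃) hE).1 n)] at h1
      have h2 : ((brLength E M₂ n).toNat : ℝ) ≤
        (brLength E M₁ n).toNat + (brLength E M₃ n).toNat := by exact_mod_cast h1
      rw [brSeq_eq htop, brSeq_eq htop, brSeq_eq htop, ← mul_add, ← mul_sub, ← add_div, ← sub_div]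
      exact mul_nonneg (by positivity) (div_nonneg (sub_nonneg.2 h2) (by positivity))
    · filter_upwards [hgap.eventually_ne_top, eventually_ge_atTop a] with n hn hna
      have h1 := ha n hna
      simp only [← brLength_eq_reesLength] at h1
      rw [← ENat.natCast_toNat ((brDefined (M := M₁) hE).1 n),
        ← ENat.natCast_toNat ((brDefined (M := M₂) hE).1 n),
        ← ENat.natCast_toNat ((brDefined (M := M₃) hE).1 n), ← ENat.natCast_toNat hn] at h1
      have h2 : ((brLength E M₁ n).toNat : ℝ) + (brLength E M₃ n).toNat ≤
        (brLength E M₂ n).toNat + (gapLength E M₁ a (n - a)).toNat := by exact_mod_cast h1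
      rw [brSeq_eq htop, brSeq_eq htop, brSeq_eq htop, ← mul_add, ← mul_sub, ← add_div, ← sub_div]
      gcongr
      linarith
  have h1 := ((brDefined (M := M₁) hE).2.add (brDefined (M := M₃) hE).2).sub
    (brDefined (M := M₂) hE).2
  linarith [tendsto_nhds_unique h1 hlim]

theorem br_congr {M' : Type*} [AddCommGroup M'] [Module R M'] [Module.Finite R M]
    [Module.Finite R M'] (φ : M ≃ₗ[R] M') (hE : Module.length R ((Fin r → R) ⧸ E) ≠ ⊤) :
    br E M = br E M' := by
  have h := br_eq_add_of_exact (E := E) (M₁ := M) (M₂ := M') (M₃ := PUnit) (f := φ.toLinearMap)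
    (g := 0) φ.injective (fun _ => ⟨0, rfl⟩)
    ((LinearMap.exact_zero_iff_surjective _ _).2 φ.surjective) hE
  rw [h, br_eq_zero (M := PUnit) brLength_of_subsingleton, add_zero]

/-- If `dim R/p < dim R`, the lengths for `R/p` grow with an exponent smaller than that of the
denominator in the definition of the multiplicity. -/
theorem br_quotient_eq_zero (hE : Module.length R ((Fin r → R) ⧸ E) ≠ ⊤) (p : Ideal R) [p.IsPrime]
    (hp : ringKrullDim (R ⧸ p) ≠ ringKrullDim R) : br E (R ⧸ p) = 0 := by
  by_cases htop : E = ⊤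
  · subst htop
    exact br_eq_zero brLength_top
  have hlt : ringKrullDim (R ⧸ p) < (dimNat R : WithBot ℕ∞) := by
    rw [coe_dimNat]
    exact lt_of_le_of_ne (ringKrullDim_quotient_le p) hp
  obtain ⟨e, he, hed⟩ : ∃ e : ℕ, ringKrullDim (R ⧸ p) ≤ e ∧ e + 1 = dimNat R := by
    have h0 : (0 : WithBot ℕ∞) ≤ ringKrullDim (R ⧸ p) := ringKrullDim_nonneg_of_nontrivial
    rcases h : dimNat R with _ | e
    · rw [h] at hlt
      exact absurd hlt (not_lt.2 (by simpa using h0))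
    · exact ⟨e, ENat.WithBot.lt_add_one_iff.1 (by simpa [h] using hlt), rfl⟩
  obtain ⟨k, hk⟩ := exists_pow_smul_top_le hE
  obtain ⟨C, hC⟩ := exists_relLength_pow_le_of_prime p he
  obtain ⟨D, hD⟩ := exists_reesLength_le hk hC
  refine br_eq_zero_of_isLowerOrder htop ⟨D, Eventually.of_forall fun n => ?_⟩
  refine (mul_le_mul_right (hD n) _).trans ?_
  norm_cast
  rw [mul_left_comm, ← hed, ← add_assoc, pow_succ' _ (r - 1 + e)]
  exact Nat.mul_le_mul_left _ (Nat.mul_le_mul_right _ (Nat.le_succ n))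

end Multiplicity

/-! ### Localization at primes of maximal dimension -/

section Local

variable {R : Type*} [CommRing R]

theorem localLength_eq_zero {M : Type*} [AddCommGroup M] [Module R M] {p : PrimeSpectrum R}
    (h : p ∉ Module.support R M) : localLength M p = 0 := by
  have := Module.notMem_support_iff.1 h
  exact Module.length_eq_zero

theorem localLength_eq_add_of_exact {M₁ M₂ M₃ : Type*} [AddCommGroup M₁] [Module R M₁]
    [AddCommGroup M₂] [Module R M₂] [AddCommGroup M₃] [Module R M₃] {f : M₁ →ₗ[R] M₂}
    {g : M₂ →ₗ[R] M₃} (hf : Function.Injective f) (hg : Function.Surjective g)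
    (hfg : Function.Exact f g) (p : PrimeSpectrum R) :
    localLength M₂ p = localLength M₁ p + localLength M₃ p :=
  Module.length_eq_add_of_exact (LocalizedModule.map p.asIdeal.primeCompl f)
    (LocalizedModule.map p.asIdeal.primeCompl g) (LocalizedModule.map_injective _ f hf)
    (LocalizedModule.map_surjective _ g hg) (LocalizedModule.map_exact _ f g hfg)

theorem localLength_congr {M M' : Type*} [AddCommGroup M] [Module R M] [AddCommGroup M']
    [Module R M'] (φ : M ≃ₗ[R] M') (p : PrimeSpectrum R) : localLength M p = localLength M' p :=
  le_antisymm
    (Module.length_le_of_injective (LocalizedModule.map p.asIdeal.primeCompl φ.toLinearMap)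
      (LocalizedModule.map_injective _ _ φ.injective))
    (Module.length_le_of_injective (LocalizedModule.map p.asIdeal.primeCompl φ.symm.toLinearMap)
      (LocalizedModule.map_injective _ _ φ.symm.injective))

theorem localLength_quotient_of_not_le {q : Ideal R} {p : PrimeSpectrum R} (h : ¬q ≤ p.asIdeal) :
    localLength (R ⧸ q) p = 0 := by
  refine localLength_eq_zero fun hp => h ?_
  rwa [Module.mem_support_iff_of_finite, Ideal.annihilator_quotient] at hp

/-- The localization of `R/p` at `p` is the residue field of `p`. -/
theorem localLength_quotient_self (p : PrimeSpectrum R) : localLength (R ⧸ p.asIdeal) p = 1 := by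
  have hmem : p ∈ Module.support R (R ⧸ p.asIdeal) := by
    rw [Module.mem_support_iff_of_finite, Ideal.annihilator_quotient]
  have hnt : Nontrivial (LocalizedModule.AtPrime p.asIdeal (R ⧸ p.asIdeal)) := hmem
  rw [localLength, Module.length_eq_one_iff, isSimpleModule_iff_toSpanSingleton_surjective]
  refine ⟨hnt, fun x hx y => ?_⟩
  induction x using LocalizedModule.induction_on with
  | _ a s =>
  induction y using LocalizedModule.induction_on with
  | _ b t =>
  obtain ⟨a, rfl⟩ := Ideal.Quotient.mk_surjective a
  obtain ⟨b, rfl⟩ := Ideal.Quotient.mk_surjective b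
  have ha : a ∈ p.asIdeal.primeCompl := fun ha => hx (by
    rw [Ideal.Quotient.eq_zero_iff_mem.2 ha, LocalizedModule.zero_mk])
  refine ⟨Localization.mk (b * s) (t * ⟨a, ha⟩), ?_⟩
  rw [LinearMap.toSpanSingleton_apply, LocalizedModule.mk_smul_mk, LocalizedModule.mk_eq]
  refine ⟨1, ?_⟩
  simp only [one_smul, Submonoid.smul_def, Submonoid.coe_mul, ← Ideal.Quotient.mk_eq_mk,
    ← Submodule.Quotient.mk_smul, smul_eq_mul]
  congr 1
  ring

end Local

section MaxDim

variable (R : Type*) [CommRing R]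

/-- The primes `p` with `dim R/p = dim R`. -/
def maxDimPrimes : Set (PrimeSpectrum R) := {p | ringKrullDim (R ⧸ p.asIdeal) = ringKrullDim R}

variable {R} [IsNoetherianRing R] [IsLocalRing R]

/-- Primes of maximal dimension are minimal. -/
theorem eq_of_le_of_mem_maxDimPrimes {q : Ideal R} [q.IsPrime] {p : PrimeSpectrum R}
    (hp : p ∈ maxDimPrimes R) (h : q ≤ p.asIdeal) : q = p.asIdeal := by
  by_contra hne
  obtain ⟨x, hxp, hxq⟩ := SetLike.exists_of_lt (lt_of_le_of_ne h hne)
  have h1 : ringKrullDim (R ⧸ p.asIdeal) + 1 ≤ ringKrullDim (R ⧸ q) := by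
    refine ringKrullDim_succ_le_of_surjective (Ideal.Quotient.factor h)
      (Ideal.Quotient.factor_surjective h) (r := Ideal.Quotient.mk q x) ?_ ?_
    · rw [mem_nonZeroDivisors_iff_ne_zero, ne_eq, Ideal.Quotient.eq_zero_iff_mem]
      exact hxq
    · rw [Ideal.Quotient.factor_mk, Ideal.Quotient.eq_zero_iff_mem]
      exact hxp
  have h2 := h1.trans (ringKrullDim_quotient_le q)
  rw [show ringKrullDim (R ⧸ p.asIdeal) = ringKrullDim R from hp, ← coe_dimNat] at h2
  norm_cast at h2
  omega

theorem finite_maxDimPrimes : (maxDimPrimes R).Finite := by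
  refine Set.Finite.of_finite_image ((minimalPrimes.finite_of_isNoetherianRing R).subset ?_)
    (f := PrimeSpectrum.asIdeal) fun p _ q _ h => PrimeSpectrum.ext h
  rintro _ ⟨p, hp, rfl⟩
  obtain ⟨q, hq, hqp⟩ := Ideal.exists_minimalPrimes_le (bot_le : ⊥ ≤ p.asIdeal)
  have := hq.isPrime
  rw [← eq_of_le_of_mem_maxDimPrimes hp hqp]
  exact hq

variable {r : ℕ} {E : Submodule R (Fin r → R)}

/-- The associativity formula, indexed by all primes of maximal dimension. Both sides are additive,
so a prime filtration reduces it to `N = R/q`, where `λ(N_p)` is `1` for `p = q` and `0` for every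
other prime `p` of maximal dimension. -/
theorem br_eq_sum (hE : Module.length R ((Fin r → R) ⧸ E) ≠ ⊤)
    (N : Type*) [AddCommGroup N] [Module R N] [hN : Module.Finite R N] :
    (∀ p ∈ maxDimPrimes R, localLength N p ≠ ⊤) ∧
    br E N = ∑ p ∈ (finite_maxDimPrimes (R := R)).toFinset,
      ((localLength N p).toNat : ℝ) * br E (R ⧸ p.asIdeal) := by
  induction hN using IsNoetherianRing.induction_on_isQuotientEquivQuotientPrime R with
  | subsingleton N =>
    have h0 : ∀ p, localLength N p = 0 := fun p => localLength_eq_zero (by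
      rw [Module.support_eq_empty (R := R) (M := N)]
      exact Set.notMem_empty p)
    refine ⟨fun p _ => by simp [h0], ?_⟩
    rw [br_eq_zero brLength_of_subsingleton]
    simp [h0]
  | quotient N p f =>
    simp only [localLength_congr f, br_congr f hE]
    have hne : ∀ q ∈ maxDimPrimes R, q ≠ p → localLength (R ⧸ p.asIdeal) q = 0 := by
      intro q hq hqp
      refine localLength_quotient_of_not_le fun hle => hqp ?_
      exact PrimeSpectrum.ext (eq_of_le_of_mem_maxDimPrimes hq hle).symm
    refine ⟨fun q hq => ?_, ?_⟩
    · by_cases hqp : q = p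
      · rw [hqp, localLength_quotient_self]
        exact ENat.one_ne_top
      · rw [hne q hq hqp]
        exact ENat.zero_ne_top
    · rw [Finset.sum_eq_single p]
      · rw [localLength_quotient_self, ENat.toNat_one, Nat.cast_one, one_mul]
      · intro q hq hqp
        rw [hne q ((Set.Finite.mem_toFinset _).1 hq) hqp, ENat.toNat_zero, Nat.cast_zero, zero_mul]
      · intro hp
        rw [br_quotient_eq_zero hE p.asIdeal fun h => hp ((Set.Finite.mem_toFinset _).2 h),
          mul_zero]
  | exact N₁ N₂ N₃ f g hf hg hfg h₁ h₃ =>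
    have hadd := localLength_eq_add_of_exact hf hg hfg
    refine ⟨fun p hp => ?_, ?_⟩
    · rw [hadd p]
      exact WithTop.add_ne_top.2 ⟨h₁.1 p hp, h₃.1 p hp⟩
    · rw [br_eq_add_of_exact hf hg hfg hE, h₁.2, h₃.2, ← Finset.sum_add_distrib]
      refine Finset.sum_congr rfl fun p hp => ?_
      rw [Set.Finite.mem_toFinset] at hp
      rw [hadd p, ENat.toNat_add (h₁.1 p hp) (h₃.1 p hp), Nat.cast_add, add_mul]

end MaxDim

end BuchsbaumRim

theorem theorem2p3 {R : Type*} [CommRing R] [IsNoetherianRing R] [IsLocalRing R]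
    (r : ℕ) (E : Submodule R (Fin r → R)) (hE : Module.length R ((Fin r → R) ⧸ E) ≠ ⊤)
    (N : Type*) [AddCommGroup N] [Module R N] [Module.Finite R N] :
    BuchsbaumRim.BrDefined E N ∧
    (BuchsbaumRim.maxDimSupport R N).Finite ∧
    (∀ p ∈ BuchsbaumRim.maxDimSupport R N,
      BuchsbaumRim.localLength N p ≠ ⊤ ∧ BuchsbaumRim.BrDefined E (R ⧸ p.asIdeal)) ∧
    BuchsbaumRim.br E N =
      ∑ᶠ p ∈ BuchsbaumRim.maxDimSupport R N,
        ((BuchsbaumRim.localLength N p).toNat : ℝ) * BuchsbaumRim.br E (R ⧸ p.asIdeal) := by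
  have hsub : BuchsbaumRim.maxDimSupport R N ⊆ BuchsbaumRim.maxDimPrimes R := fun _ hp => hp.2
  have hfin := BuchsbaumRim.finite_maxDimPrimes.subset hsub
  obtain ⟨hlen, hsum⟩ := BuchsbaumRim.br_eq_sum hE N
  refine ⟨BuchsbaumRim.brDefined hE, hfin,
    fun p hp => ⟨hlen p (hsub hp), BuchsbaumRim.brDefined hE⟩, ?_⟩
  rw [finsum_mem_eq_finite_toFinset_sum _ hfin, hsum]
  refine (Finset.sum_subset (Set.Finite.toFinset_subset_toFinset.2 hsub) fun p hp hnp => ?_).symm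
  rw [Set.Finite.mem_toFinset] at hp hnp
  rw [BuchsbaumRim.localLength_eq_zero fun h => hnp ⟨h, hp⟩, ENat.toNat_zero, Nat.cast_zero,
    zero_mul]
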